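/- For each $N\ge 1$ let $\lambda_1^N,\dots,\lambda_N^N$ be real numbers. Assume that the empirical measures $\frac1N\sum_{i=1}^N\delta_{\lambda_i^N}$ converge weakly to a compactly supported probability measure $\mu$ on $\mathbb R$, and that $\min_i\lambda_i^N\to\lambda_{\min}$ and $\max_i\lambda_i^N\to\lambda_{\max}$ with $\lambda_{\min},\lambda_{\max}$ finite. (The support of $\mu$ is then contained in $[\lambda_{\min},\lambda_{\max}]$.) Put $H(z)=\int\frac{1}{z-\lambda}\,d\mu(\lambda)$ for $z\in\mathbb R\setminus[\lambda_{\min},\lambda_{\max}]$, $H_{\max}=\lim_{z\downarrow\lambda_{\max}}H(z)$ and $H_{\min}=\lim_{z\uparrow\lambda_{\min}}H(z)$; these limits exist in $]0,+\infty]$ and $[-\infty,0[$ respectively. Put $\alpha_{\max}=\lambda_{\max}-\frac1{H_{\max}}$, $\alpha_{\min}=\lambda_{\min}-\frac1{H_{\min}}$ (with $\frac1{\pm\infty}=0$) and $m=\int\lambda\,d\mu(\lambda)$. Every $\gamma\in I':=\,]H_{\min},H_{\max}[\,\setminus\{0\}$ equals $H(z)$ for exactly one $z\in\mathbb R\setminus[\lambda_{\min},\lambda_{\max}]$,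 denoted $K(\gamma)$. Put $R(\gamma)=K(\gamma)-\frac1\gamma$ on $I'$; every $\alpha\in\,]\alpha_{\min},\alpha_{\max}[\,\setminus\{m\}$ equals $R(\gamma)$ for exactly one $\gamma\in I'$, denoted $Q(\alpha)$. For $\kappa\notin[\lambda_{\min},\lambda_{\max}]$ let $$h_\alpha(\kappa)=\int\log\Big(\frac{\kappa-\lambda}{\kappa-\alpha}\Big)d\mu(\lambda),$$ and let $h_\alpha^{\max}=\lim_{\kappa\downarrow\lambda_{\max}}h_\alpha(\kappa)$ for $\alpha\in[\alpha_{\max},\lambda_{\max}[$ and $h_\alpha^{\min}=\lim_{\kappa\uparrow\lambda_{\min}}h_\alpha(\kappa)$ for $\alpha\in\,]\lambda_{\min},\alpha_{\min}]$; these limits exist in $\mathbb R$. Define $$T(\alpha)=\begin{cases}0 & \text{if }\alpha=m,\\ \frac12h_\alpha(K(Q(\alpha))) & \text{if }\alpha\in\,]\alpha_{\min},\alpha_{\max}[\,\setminus\{m\},\\ \frac12h_\alpha^{\max} & \text{if }\alpha\in[\alpha_{\max},\lambda_{\max}[\,\setminus\{m\},\\ \frac12h_\alpha^{\min} & \text{if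 }\alpha\in\,]\lambda_{\min},\alpha_{\min}]\setminus\{m\},\\ +\infty & \text{if }\alpha\notin\,]\lambda_{\min},\lambda_{\max}[\text{ and }\alpha\neq m.\end{cases}$$ The values at $m$, $\alpha_{\max}$ and $\alpha_{\min}$ are the extension by continuity of $\frac12h_\alpha(K(Q(\alpha)))$ to $[\alpha_{\min},\alpha_{\max}]$ (when $\mu$ is a Dirac mass, $\alpha_{\min}=\alpha_{\max}=m$ and $T(m)=0$). Then $T$ is a good rate function on $\mathbb R$ (nonnegative, lower semicontinuous, with compact sublevel sets), and the law $\hat\pi_N$ of $$z_N=\frac{\sum_{i=1}^N\lambda_i^N g_i^2}{\sum_{i=1}^N g_i^2}$$ under the standard $N$-dimensional Gaussian measure satisfies a large deviation principle in the scale $N$ with rate function $T$: for every closed $F\subset\mathbb R$ and every open $G\subset\mathbb R$, $$\limsup_{N\to\infty}\frac1N\log\hat\pi_N(F)\le-\inf_FT,\qquad \liminf_{N\to\infty}\frac1N\log\hat\pi_N(G)\ge-\inf_GT.$$ -/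

import Mathlib

open MeasureTheory ProbabilityTheory Filter Topology Set
open scoped ENNReal BoundedContinuousFunction

noncomputable section

/-! ### Large deviation principles -/

/-- A good rate function: nonnegative, lower semicontinuous, with compact sublevel sets. -/
structure IsGoodRateFunction {X : Type*} [TopologicalSpace X] (I : X → EReal) : Prop where
  nonneg : ∀ x, 0 ≤ I x
  lowerSemicontinuous : LowerSemicontinuous I
  isCompact_sublevel : ∀ c : ℝ, IsCompact {x | I x ≤ (c : EReal)}

/-- The sequence of laws `P N` satisfies a large deviation principle in the scale `N` with rate
function `I`: the upper bound holds for closed sets and the lower bound for open sets. Here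
`ENNReal.log 0 = ⊥`. -/
structure SatisfiesLDP {X : Type*} [TopologicalSpace X] [MeasurableSpace X]
    (P : ℕ → Measure X) (I : X → EReal) : Prop where
  upper : ∀ F : Set X, IsClosed F →
    limsup (fun N : ℕ => (((N : ℝ)⁻¹ : ℝ) : EReal) * ENNReal.log (P N F)) atTop
      ≤ -(⨅ x ∈ F, I x)
  lower : ∀ G : Set X, IsOpen G →
    -(⨅ x ∈ G, I x)
      ≤ liminf (fun N : ℕ => (((N : ℝ)⁻¹ : ℝ) : EReal) * ENNReal.log (P N G)) atTop

/-! ### The random variable and its law -/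

/-- The empirical measure `(1/N) ∑ δ_{x_i}`. -/
def empMeasure {N : ℕ} (x : Fin N → ℝ) : Measure ℝ :=
  (N : ℝ≥0∞)⁻¹ • ∑ i, Measure.dirac (x i)

/-- The standard Gaussian measure on `ℝ^N`. -/
def stdGaussianPi (N : ℕ) : Measure (Fin N → ℝ) :=
  Measure.pi fun _ => gaussianReal 0 1

/-- `z_N = (∑ λ_i g_i²) / (∑ g_i²)`. -/
def rayleighRatio {N : ℕ} (x : Fin N → ℝ) (g : Fin N → ℝ) : ℝ :=
  (∑ i, x i * g i ^ 2) / ∑ i, g i ^ 2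

/-- The law of `z_N` under the standard Gaussian measure. -/
def rayleighLaw (lam : (N : ℕ) → Fin N → ℝ) (N : ℕ) : Measure ℝ :=
  (stdGaussianPi N).map (rayleighRatio (lam N))

/-- The empirical measures of the array `lam` converge weakly to the compactly supported measure
`μ`, and the smallest and largest entries converge to the finite numbers `lmin` and `lmax`. -/
structure SpectralHypothesis (lam : (N : ℕ) → Fin N → ℝ) (μ : Measure ℝ) (lmin lmax : ℝ) :
    Prop where
  isCompact_support : IsCompact μ.support
  tendsto_empMeasure : ∀ f : ℝ →ᵇ ℝ,
    Tendsto (fun N => ∫ x, f x ∂(empMeasure (lam N))) atTop (𝓝 (∫ x, f x ∂μ))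
  tendsto_min : Tendsto (fun N => ⨅ i, lam N i) atTop (𝓝 lmin)
  tendsto_max : Tendsto (fun N => ⨆ i, lam N i) atTop (𝓝 lmax)

/-! ### The Hilbert transform, its inverse `K`, and the `R`-transform with its inverse `Q` -/

/-- `H_μ(z) = ∫ 1/(z-λ) dμ(λ)`. -/
def hilbertTransform (μ : Measure ℝ) (z : ℝ) : ℝ := ∫ l, 1 / (z - l) ∂μ

/-- `H_max`, the limit of `H_μ(z)` as `z` decreases to `lmax`; it may be `+∞`. -/
def hilbertMax (μ : Measure ℝ) (lmax : ℝ) : EReal :=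
  limUnder (𝓝[>] lmax) fun z => (hilbertTransform μ z : EReal)

/-- `H_min`, the limit of `H_μ(z)` as `z` increases to `lmin`; it may be `-∞`. -/
def hilbertMin (μ : Measure ℝ) (lmin : ℝ) : EReal :=
  limUnder (𝓝[<] lmin) fun z => (hilbertTransform μ z : EReal)

/-- `]H_min, H_max[ \ {0}`, the domain of `K_μ` and `R_μ`. -/
def domainK (μ : Measure ℝ) (lmin lmax : ℝ) : Set ℝ :=
  {γ | hilbertMin μ lmin < (γ : EReal) ∧ (γ : EReal) < hilbertMax μ lmax ∧ γ ≠ 0}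

/-- `K_μ`, the inverse of the restriction of `H_μ` to the complement of `[lmin, lmax]`. -/
def kTransform (μ : Measure ℝ) (lmin lmax : ℝ) : ℝ → ℝ :=
  Function.invFunOn (hilbertTransform μ) (Icc lmin lmax)ᶜ

/-- `R_μ(γ) = K_μ(γ) - 1/γ`. -/
def rTransform (μ : Measure ℝ) (lmin lmax : ℝ) (γ : ℝ) : ℝ :=
  kTransform μ lmin lmax γ - 1 / γ

/-- `Q_μ`, the inverse of `R_μ`. -/
def qTransform (μ : Measure ℝ) (lmin lmax : ℝ) : ℝ → ℝ :=
  Function.invFunOn (rTransform μ lmin lmax) (domainK μ lmin lmax)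

/-- `m = ∫ λ dμ(λ)`. -/
def spectralMean (μ : Measure ℝ) : ℝ := ∫ l, l ∂μ

/-- `α_max = lmax - 1/H_max`, with `1/∞ = 0` (which is the inverse of `EReal`). -/
def alphaMax (μ : Measure ℝ) (lmax : ℝ) : ℝ := lmax - ((hilbertMax μ lmax)⁻¹).toReal

/-- `α_min = lmin - 1/H_min`, with `1/(-∞) = 0`. -/
def alphaMin (μ : Measure ℝ) (lmin : ℝ) : ℝ := lmin - ((hilbertMin μ lmin)⁻¹).toReal

/-- `]α_min, α_max[ \ {m}`, the domain of `Q_μ`. -/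
def domainQ (μ : Measure ℝ) (lmin lmax : ℝ) : Set ℝ :=
  Ioo (alphaMin μ lmin) (alphaMax μ lmax) \ {spectralMean μ}

/-! ### The rate function -/

/-- `h_α(κ) = ∫ log((κ-λ)/(κ-α)) dμ(λ)`. -/
def hFun (μ : Measure ℝ) (α κ : ℝ) : ℝ := ∫ l, Real.log ((κ - l) / (κ - α)) ∂μ

/-- `h_α^max`, the limit of `h_α(κ)` as `κ` decreases to `lmax`. -/
def hMax (μ : Measure ℝ) (lmax α : ℝ) : ℝ := limUnder (𝓝[>] lmax) (hFun μ α)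

/-- `h_α^min`, the limit of `h_α(κ)` as `κ` increases to `lmin`. -/
def hMin (μ : Measure ℝ) (lmin α : ℝ) : ℝ := limUnder (𝓝[<] lmin) (hFun μ α)

open Classical in
/-- The rate function `T`. On `[α_min, α_max]` the expression `h_α(K_μ(Q_μ(α)))/2` is extended by
continuity to the points where `Q_μ` is not defined: `K_μ(Q_μ(α))` tends to infinity and
`h_α(κ)` to `0` at the mean `m`, while `K_μ(Q_μ(α))` tends to `lmax` (resp. `lmin`) at
`α_max` (resp. `α_min`). -/
def rateT (μ : Measure ℝ) (lmin lmax α : ℝ) : EReal :=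
  if α = spectralMean μ then 0
  else if α ∈ domainQ μ lmin lmax then
    ((hFun μ α (kTransform μ lmin lmax (qTransform μ lmin lmax α)) / 2 : ℝ) : EReal)
  else if alphaMax μ lmax ≤ α ∧ α < lmax then ((hMax μ lmax α / 2 : ℝ) : EReal)
  else if lmin < α ∧ α ≤ alphaMin μ lmin then ((hMin μ lmin α / 2 : ℝ) : EReal)
  else ⊤

end

/-! ### The Hilbert transform to the right of the support -/

section RightOfSupport

variable {μ : Measure ℝ} [IsProbabilityMeasure μ] {a b : ℝ}

/-! To the right of the mean `m`, the rate is `T(α) = ½ sup h_α(κ)`, the supremum being over `κ >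
λmax`. The event `z_N ≥ α` forces `∑ (λ_i - α) g_i² ≥ 0`. The exponential Chebyshev inequality with
parameter `1 / (2(κ - α))` bounds its probability by `∏ ((κ - λ_i)/(κ - α))^(-1/2)`, so the
exponential rate is at most `-½ h_α(κ)` for every `κ > λmax` (`rayleighLaw_Ici_le`).

Formally `h_α'(κ) = H(κ) - 1/(κ - α)`, so a critical point solves `κ - 1/H(κ) = α`, that is `κ =
K(Q(α))`. The function `z - 1/H(z)` is antitone on `]λmax, ∞[`, tends to `α_max` at `λmax`, and
takes values below any prescribed number above `m`. Hence a critical point exists for `m < α <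
α_max`, and it is the maximum of `h_α`. For `α ≥ α_max` one has `(κ - α) H(κ) ≤ 1` throughout, `h_α`
decreases, and the supremum is the limit at `λmax`. Everything about `H` and `h_α` is obtained by
integrating pointwise identities and inequalities, without differentiating
(`sub_mul_hilbertTransform_sub_one`, `hFun_le_hFun_add`).

The lower bound is a change of measure: give `g_i` the variance `(κ - α)/(κ - λ_i)` suggested by the
Chernoff tilt. At a critical point this centres `z_N` at `α`. When `(κ - α) H(κ) < 1`, the variances
alone place it below `α`, and the deficit is made up by a shift of order `√N` in a coordinate
carrying the largest `λ_i`. The extra cost vanishes as `κ` decreases to `λmax`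
(`le_expGrowthInf_rayleighLaw`, `le_expGrowthInf_rayleighLaw_of_le_one`).

The left of the mean follows by the reflection `λ ↦ -λ`. The same supremum formula exhibits the
sublevel sets of `T` as intersections of closed conditions, one for each `κ`, whence goodness. -/

theorem integrable_of_continuousOn_Icc (hμ : ∀ᵐ l ∂μ, l ∈ Icc a b) {f : ℝ → ℝ}
    (hf : ContinuousOn f (Icc a b)) : Integrable f μ := by
  rw [← Measure.restrict_eq_self_of_ae_mem hμ]
  exact hf.integrableOn_compact isCompact_Icc

theorem integral_pos_of_ae_pos {f : ℝ → ℝ} (hf : Integrable f μ) (h : ∀ᵐ l ∂μ, 0 < f l) :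
    0 < ∫ l, f l ∂μ := by
  have h0 : 0 ≤ᵐ[μ] f := h.mono fun l hl => hl.le
  refine lt_of_le_of_ne (integral_nonneg_of_ae h0) fun h1 => ?_
  have h2 := (integral_eq_zero_iff_of_nonneg_ae h0 hf).1 h1.symm
  have h3 : ∀ᵐ _ ∂μ, False := by
    filter_upwards [h, h2] with l h4 h5
    simp only [Pi.zero_apply] at h5
    linarith
  exact h3.exists.elim fun _ h => h

theorem left_le_right_of_ae_mem_Icc (hμ : ∀ᵐ l ∂μ, l ∈ Icc a b) : a ≤ b := by
  obtain ⟨l, hl⟩ := hμ.exists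
  exact hl.1.trans hl.2

theorem integrable_id_of_ae_mem_Icc (hμ : ∀ᵐ l ∂μ, l ∈ Icc a b) : Integrable (fun l => l) μ :=
  integrable_of_continuousOn_Icc hμ continuousOn_id

theorem spectralMean_mem_Icc (hμ : ∀ᵐ l ∂μ, l ∈ Icc a b) : spectralMean μ ∈ Icc a b := by
  have hi := integrable_id_of_ae_mem_Icc hμ
  constructor
  · have := integral_mono_ae (integrable_const a) hi (hμ.mono fun l hl => hl.1)
    simpa [spectralMean] using this
  · have := integral_mono_ae hi (integrable_const b) (hμ.mono fun l hl => hl.2)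
    simpa [spectralMean] using this

theorem integrable_inv_sub (hμ : ∀ᵐ l ∂μ, l ∈ Icc a b) {z : ℝ} (hz : b < z) :
    Integrable (fun l => 1 / (z - l)) μ := by
  refine integrable_of_continuousOn_Icc hμ (continuousOn_const.div (by fun_prop) fun l hl => ?_)
  linarith [hl.2]

theorem hilbertTransform_pos (hμ : ∀ᵐ l ∂μ, l ∈ Icc a b) {z : ℝ} (hz : b < z) :
    0 < hilbertTransform μ z :=
  integral_pos_of_ae_pos (integrable_inv_sub hμ hz) <| hμ.mono fun l hl =>
    one_div_pos.2 (by linarith [hl.2])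

theorem hilbertTransform_le (hμ : ∀ᵐ l ∂μ, l ∈ Icc a b) {z : ℝ} (hz : b < z) :
    hilbertTransform μ z ≤ 1 / (z - b) := by
  have := integral_mono_ae (integrable_inv_sub hμ hz) (integrable_const (1 / (z - b)))
    (hμ.mono fun l hl => one_div_le_one_div_of_le (by linarith) (by linarith [hl.2]))
  simpa [hilbertTransform] using this

theorem strictAntiOn_hilbertTransform (hμ : ∀ᵐ l ∂μ, l ∈ Icc a b) :
    StrictAntiOn (hilbertTransform μ) (Ioi b) := by
  intro x hx y hy hxy
  have hx' : b < x := hx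
  have hy' : b < y := hy
  have := integral_pos_of_ae_pos ((integrable_inv_sub hμ hx').sub (integrable_inv_sub hμ hy'))
    (hμ.mono fun l hl => sub_pos.2 (one_div_lt_one_div_of_lt (by linarith [hl.2]) (by linarith)))
  simp only [Pi.sub_apply] at this
  rw [integral_sub (integrable_inv_sub hμ hx') (integrable_inv_sub hμ hy')] at this
  simp only [hilbertTransform]
  linarith

theorem continuousOn_hilbertTransform (hμ : ∀ᵐ l ∂μ, l ∈ Icc a b) :
    ContinuousOn (hilbertTransform μ) (Ioi b) := by
  intro z hz
  have hz' : b < z := hz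
  refine ContinuousAt.continuousWithinAt ?_
  have hev : ∀ᶠ x in 𝓝 z, (z + b) / 2 < x := lt_mem_nhds (by linarith)
  refine continuousAt_of_dominated (bound := fun _ => 1 / ((z - b) / 2)) ?_ ?_ ?_ ?_
  · filter_upwards [hev] with x hx
    exact (integrable_inv_sub hμ (by linarith)).aestronglyMeasurable
  · filter_upwards [hev] with x hx
    filter_upwards [hμ] with l hl
    have : 0 < x - l := by linarith [hl.2]
    rw [Real.norm_of_nonneg (by positivity)]
    exact one_div_le_one_div_of_le (by linarith) (by linarith [hl.2])
  · exact integrable_const _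
  · filter_upwards [hμ] with l hl
    have : z - l ≠ 0 := by linarith [hl.2]
    fun_prop (disch := assumption)

theorem tendsto_hilbertMax (hμ : ∀ᵐ l ∂μ, l ∈ Icc a b) :
    Tendsto (fun z => (hilbertTransform μ z : EReal)) (𝓝[>] b) (𝓝 (hilbertMax μ b)) := by
  have hanti : AntitoneOn (fun z => (hilbertTransform μ z : EReal)) (Ioi b) := fun x hx y hy hxy =>
    EReal.coe_le_coe_iff.2 ((strictAntiOn_hilbertTransform hμ).antitoneOn hx hy hxy)
  exact tendsto_nhds_limUnder ⟨_, hanti.tendsto_nhdsGT (OrderTop.bddAbove _)⟩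

theorem hilbertTransform_lt_hilbertMax (hμ : ∀ᵐ l ∂μ, l ∈ Icc a b) {z : ℝ} (hz : b < z) :
    (hilbertTransform μ z : EReal) < hilbertMax μ b := by
  have h1 : (hilbertTransform μ ((b + z) / 2) : EReal) ≤ hilbertMax μ b := by
    refine ge_of_tendsto (tendsto_hilbertMax hμ) ?_
    filter_upwards [Ioo_mem_nhdsGT (show b < (b + z) / 2 by linarith)] with x hx
    refine EReal.coe_le_coe_iff.2 ((strictAntiOn_hilbertTransform hμ).antitoneOn hx.1 ?_ hx.2.le)
    simp only [mem_Ioi]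
    linarith
  refine lt_of_lt_of_le (EReal.coe_lt_coe_iff.2 (strictAntiOn_hilbertTransform hμ ?_ hz ?_)) h1
  · simp only [mem_Ioi]
    linarith
  · linarith

theorem hilbertMax_pos (hμ : ∀ᵐ l ∂μ, l ∈ Icc a b) : 0 < hilbertMax μ b :=
  (EReal.coe_pos.2 (hilbertTransform_pos hμ (lt_add_one b))).trans
    (hilbertTransform_lt_hilbertMax hμ (lt_add_one b))

theorem exists_hilbertTransform_eq (hμ : ∀ᵐ l ∂μ, l ∈ Icc a b) {γ : ℝ} (h0 : 0 < γ)
    (h1 : (γ : EReal) < hilbertMax μ b) : ∃ z, b < z ∧ hilbertTransform μ z = γ := by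
  obtain ⟨x, hx1, hx2⟩ := (((tendsto_hilbertMax hμ).eventually_const_lt h1).and
    self_mem_nhdsWithin).exists
  have hx1 : γ < hilbertTransform μ x := EReal.coe_lt_coe_iff.1 hx1
  have hx2 : b < x := hx2
  -- The point where the bound `H(z) ≤ 1/(z - b)` equals `γ`.
  have hy1 : b < b + 1 / γ := by linarith [one_div_pos.2 h0]
  have hy : hilbertTransform μ (b + 1 / γ) ≤ γ := by
    have := hilbertTransform_le hμ hy1
    simpa using this
  obtain ⟨z, hz, hz'⟩ := isPreconnected_Ioi.intermediate_value (a := b + 1 / γ) (b := x) hy1 hx2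
    (continuousOn_hilbertTransform hμ) ⟨hy, hx1.le⟩
  exact ⟨z, hz, hz'⟩

/-- Jensen's inequality for `1 / (z - l)`. -/
theorem one_le_sub_mean_mul_hilbertTransform (hμ : ∀ᵐ l ∂μ, l ∈ Icc a b) {z : ℝ} (hz : b < z) :
    1 ≤ (z - spectralMean μ) * hilbertTransform μ z := by
  have hm := spectralMean_mem_Icc hμ
  have hp : 0 < z - spectralMean μ := by linarith [hm.2]
  have hi := integrable_id_of_ae_mem_Icc hμ
  -- Tangent line at `1`: `1/x ≥ 2 - x` with `x = (z - l)/(z - m)`, whose mean is `1`.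
  have h := integral_mono_ae
    (f := fun l => 2 - (z - l) / (z - spectralMean μ))
    (g := fun l => (z - spectralMean μ) * (1 / (z - l)))
    ((integrable_const _).sub (((integrable_const _).sub hi).div_const _))
    ((integrable_inv_sub hμ hz).const_mul _) ?_
  · have e : ∫ l, (2 - (z - l) / (z - spectralMean μ)) ∂μ = 1 := by
      have h1 : Integrable (fun l => z - l) μ := (integrable_const z).sub hi
      rw [integral_sub (integrable_const _) (h1.div_const _), integral_div,
        integral_sub (integrable_const _) hi, ← spectralMean]
      simp only [integral_const, probReal_univ, smul_eq_mul, one_mul]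
      rw [div_self hp.ne']
      norm_num
    rw [integral_const_mul, e] at h
    simp only [hilbertTransform]
    linarith
  · filter_upwards [hμ] with l hl
    have hq : 0 < z - l := by linarith [hl.2]
    have : (z - spectralMean μ) * (1 / (z - l)) - (2 - (z - l) / (z - spectralMean μ))
        = ((z - spectralMean μ) - (z - l)) ^ 2 / ((z - l) * (z - spectralMean μ)) := by
      field_simp
      ring
    have h2 : 0 ≤ ((z - spectralMean μ) - (z - l)) ^ 2 / ((z - l) * (z - spectralMean μ)) := by
      positivity
    linarith

/-- The identity already holds pointwise in `l` before integration. The subtracted square term is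
nonnegative when `x ≤ y`, so once `(z - α) H(z) - 1` is nonpositive at some `z ≥ α` it stays so.
This single crossing replaces any study of the derivative of `z - 1/H(z)`. -/
theorem sub_mul_hilbertTransform_sub_one (hμ : ∀ᵐ l ∂μ, l ∈ Icc a b) {α x y : ℝ} (hx : b < x)
    (hy : b < y) (hαy : α < y) :
    (y - α) * hilbertTransform μ y - 1
      = (x - α) / (y - α) * ((x - α) * hilbertTransform μ x - 1)
        - (y - x) / (y - α) * ∫ l, (l - α) ^ 2 / ((y - l) * (x - l)) ∂μ := by
  have hix := integrable_inv_sub hμ hx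
  have hiy := integrable_inv_sub hμ hy
  have h1 : ∀ z, b < z → (z - α) * hilbertTransform μ z - 1
      = ∫ l, ((z - α) * (1 / (z - l)) - 1) ∂μ := fun z hz => by
    rw [integral_sub ((integrable_inv_sub hμ hz).const_mul _) (integrable_const _),
      integral_const_mul]
    simp [hilbertTransform]
  have hc : ContinuousOn (fun l => (l - α) ^ 2 / ((y - l) * (x - l))) (Icc a b) := by
    refine ContinuousOn.div (by fun_prop) (by fun_prop) fun l hl => ?_
    have : y - l ≠ 0 := by linarith [hl.2]
    have : x - l ≠ 0 := by linarith [hl.2]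
    positivity
  rw [h1 y hy, h1 x hx, ← integral_const_mul, ← integral_const_mul, ← integral_sub]
  · refine integral_congr_ae ?_
    filter_upwards [hμ] with l hl
    have : y - l ≠ 0 := by linarith [hl.2]
    have : x - l ≠ 0 := by linarith [hl.2]
    have : y - α ≠ 0 := by linarith
    field_simp
    ring
  · exact ((hix.const_mul _).sub (integrable_const _)).const_mul _
  · exact (integrable_of_continuousOn_Icc hμ hc).const_mul _

theorem sub_mul_hilbertTransform_le_one (hμ : ∀ᵐ l ∂μ, l ∈ Icc a b) {α x y : ℝ} (hx : b < x)
    (hxy : x ≤ y) (hα : α ≤ x) (h : (x - α) * hilbertTransform μ x ≤ 1) :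
    (y - α) * hilbertTransform μ y ≤ 1 := by
  rcases eq_or_lt_of_le hxy with rfl | hxy
  · exact h
  have h1 := sub_mul_hilbertTransform_sub_one hμ hx (hx.trans hxy) (hα.trans_lt hxy)
  have h2 : 0 ≤ ∫ l, (l - α) ^ 2 / ((y - l) * (x - l)) ∂μ := by
    refine integral_nonneg_of_ae ?_
    filter_upwards [hμ] with l hl
    have : 0 < y - l := by linarith [hl.2]
    have : 0 < x - l := by linarith [hl.2]
    simp only [Pi.zero_apply]
    positivity
  have h3 : (x - α) / (y - α) * ((x - α) * hilbertTransform μ x - 1) ≤ 0 :=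
    mul_nonpos_of_nonneg_of_nonpos (div_nonneg (by linarith) (by linarith)) (by linarith)
  have h4 : 0 ≤ (y - x) / (y - α) * ∫ l, (l - α) ^ 2 / ((y - l) * (x - l)) ∂μ :=
    mul_nonneg (div_nonneg (by linarith) (by linarith)) h2
  linarith

/-- Two distinct solutions would make the integral of `(l - α)²` against a positive weight vanish;
then `μ` is the Dirac mass at `α` and `α` is the mean. -/
theorem eq_of_sub_mul_hilbertTransform_eq_one (hμ : ∀ᵐ l ∂μ, l ∈ Icc a b) {α x y : ℝ}
    (hx : b < x) (hy : b < y) (h1 : (x - α) * hilbertTransform μ x = 1)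
    (h2 : (y - α) * hilbertTransform μ y = 1) (hm : α ≠ spectralMean μ) : x = y := by
  wlog hxy : x ≤ y generalizing x y
  · exact (this hy hx h2 h1 (le_of_not_ge hxy)).symm
  by_contra hne
  have hxy : x < y := lt_of_le_of_ne hxy hne
  have hαy : α < y := by
    have := hilbertTransform_pos hμ hy
    by_contra hcon
    have : (y - α) * hilbertTransform μ y ≤ 0 :=
      mul_nonpos_of_nonpos_of_nonneg (by linarith) this.le
    linarith
  have h3 := sub_mul_hilbertTransform_sub_one hμ hx hy hαy
  rw [h1, h2] at h3
  have h4 : 0 < (y - x) / (y - α) := div_pos (by linarith) (by linarith)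
  have h5 : ∫ l, (l - α) ^ 2 / ((y - l) * (x - l)) ∂μ = 0 := by
    have : (y - x) / (y - α) * ∫ l, (l - α) ^ 2 / ((y - l) * (x - l)) ∂μ = 0 := by linarith
    exact (mul_eq_zero.1 this).resolve_left h4.ne'
  have hc : ContinuousOn (fun l => (l - α) ^ 2 / ((y - l) * (x - l))) (Icc a b) := by
    refine ContinuousOn.div (by fun_prop) (by fun_prop) fun l hl => ?_
    have : y - l ≠ 0 := by linarith [hl.2]
    have : x - l ≠ 0 := by linarith [hl.2]
    positivity
  rw [integral_eq_zero_iff_of_nonneg_ae _ (integrable_of_continuousOn_Icc hμ hc)] at h5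
  · have h6 : ∀ᵐ l ∂μ, l = α := by
      filter_upwards [hμ, h5] with l hl h7
      have : y - l ≠ 0 := by linarith [hl.2]
      have : x - l ≠ 0 := by linarith [hl.2]
      simp only [Pi.zero_apply, div_eq_zero_iff, mul_eq_zero, this, ‹y - l ≠ 0›, or_false] at h7
      exact sub_eq_zero.1 (pow_eq_zero_iff (by norm_num) |>.1 h7)
    apply hm
    have : spectralMean μ = ∫ _, α ∂μ := integral_congr_ae h6
    simp [this]
  · filter_upwards [hμ] with l hl
    have : 0 < y - l := by linarith [hl.2]
    have : 0 < x - l := by linarith [hl.2]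
    simp only [Pi.zero_apply]
    positivity

theorem sub_inv_hilbertTransform_le_iff (hμ : ∀ᵐ l ∂μ, l ∈ Icc a b) {α z : ℝ} (hz : b < z) :
    z - 1 / hilbertTransform μ z ≤ α ↔ (z - α) * hilbertTransform μ z ≤ 1 := by
  have hp := hilbertTransform_pos hμ hz
  rw [sub_le_comm, le_div_iff₀ hp]

theorem sub_inv_hilbertTransform_eq_iff (hμ : ∀ᵐ l ∂μ, l ∈ Icc a b) {α z : ℝ} (hz : b < z) :
    z - 1 / hilbertTransform μ z = α ↔ (z - α) * hilbertTransform μ z = 1 := by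
  have hp := hilbertTransform_pos hμ hz
  rw [sub_eq_iff_eq_add', ← sub_eq_iff_eq_add, eq_div_iff hp.ne']

/-- Single crossing applied with `α = x - 1/H(x)`. -/
theorem antitoneOn_sub_inv_hilbertTransform (hμ : ∀ᵐ l ∂μ, l ∈ Icc a b) :
    AntitoneOn (fun z => z - 1 / hilbertTransform μ z) (Ioi b) := by
  intro x hx y hy hxy
  have hp := hilbertTransform_pos hμ hx
  refine (sub_inv_hilbertTransform_le_iff hμ hy).2
    (sub_mul_hilbertTransform_le_one hμ hx hxy ?_
      ((sub_inv_hilbertTransform_le_iff hμ hx).1 le_rfl))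
  have := one_div_pos.2 hp
  linarith

theorem spectralMean_le_sub_inv_hilbertTransform (hμ : ∀ᵐ l ∂μ, l ∈ Icc a b) {z : ℝ}
    (hz : b < z) : spectralMean μ ≤ z - 1 / hilbertTransform μ z := by
  have hp := hilbertTransform_pos hμ hz
  have := one_le_sub_mean_mul_hilbertTransform hμ hz
  rw [le_sub_comm, div_le_iff₀ hp]
  exact this

/-! ### The range of `z - 1/H(z)` and the endpoint `α_max` -/

theorem tendsto_alphaMax (hμ : ∀ᵐ l ∂μ, l ∈ Icc a b) :
    Tendsto (fun z => z - 1 / hilbertTransform μ z) (𝓝[>] b) (𝓝 (alphaMax μ b)) := by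
  have hid : Tendsto (fun z : ℝ => z) (𝓝[>] b) (𝓝 b) := tendsto_nhdsWithin_of_tendsto_nhds tendsto_id
  refine hid.sub ?_
  have ht := tendsto_hilbertMax hμ
  have hpos := hilbertMax_pos hμ
  induction hH : hilbertMax μ b using EReal.rec with
  | bot => simp [hH] at hpos
  | top =>
    rw [hH, EReal.tendsto_coe_nhds_top_iff] at ht
    simpa [Function.comp_def] using tendsto_inv_atTop_zero.comp ht
  | coe x =>
    rw [hH, EReal.tendsto_coe] at ht
    rw [hH, EReal.coe_pos] at hpos
    rw [← EReal.coe_inv, EReal.toReal_coe]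
    simpa using ht.inv₀ hpos.ne'

theorem sub_inv_hilbertTransform_le_alphaMax (hμ : ∀ᵐ l ∂μ, l ∈ Icc a b) {z : ℝ} (hz : b < z) :
    z - 1 / hilbertTransform μ z ≤ alphaMax μ b := by
  refine ge_of_tendsto (tendsto_alphaMax hμ) ?_
  filter_upwards [Ioo_mem_nhdsGT hz] with x hx
  exact antitoneOn_sub_inv_hilbertTransform hμ hx.1 hz hx.2.le

theorem spectralMean_le_alphaMax (hμ : ∀ᵐ l ∂μ, l ∈ Icc a b) : spectralMean μ ≤ alphaMax μ b :=
  (spectralMean_le_sub_inv_hilbertTransform hμ (lt_add_one b)).trans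
    (sub_inv_hilbertTransform_le_alphaMax hμ (lt_add_one b))

theorem alphaMax_le (hμ : ∀ᵐ l ∂μ, l ∈ Icc a b) : alphaMax μ b ≤ b := by
  have := EReal.toReal_nonneg (EReal.inv_nonneg_of_nonneg (hilbertMax_pos hμ).le)
  simp only [alphaMax]
  linarith

/-- Expand `1/(z - l)` to second order around `1/(z - m)`. The linear term has mean zero, and for
large `z` the remainder is at most `(α - m)/(z - m)²`, which gives `(z - α) H(z) ≤ 1 - (α - m)²/(z -
m)²`. -/
theorem exists_sub_mul_hilbertTransform_le_one (hμ : ∀ᵐ l ∂μ, l ∈ Icc a b) {α : ℝ}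
    (h0 : spectralMean μ < α) : ∃ z, b < z ∧ (z - α) * hilbertTransform μ z ≤ 1 := by
  have hi := integrable_id_of_ae_mem_Icc hμ
  have hm := spectralMean_mem_Icc hμ
  set m := spectralMean μ with hm_def
  have hd : 0 < α - m := sub_pos.2 h0
  set V := (b - a) ^ 2
  have hV : 0 ≤ V / (α - m) := by positivity
  -- The last condition says `(b - a)² ≤ (α - m)(z - b)`, which bounds the quadratic remainder.
  obtain ⟨z, hzb, hzα, hzV⟩ : ∃ z, b < z ∧ α < z ∧ V / (α - m) ≤ z - b :=
    ⟨max b α + 1 + V / (α - m), by linarith [le_max_left b α], by linarith [le_max_right b α],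
      by linarith [le_max_left b α]⟩
  refine ⟨z, hzb, ?_⟩
  have hp : 0 < z - m := by linarith [hm.2]
  have hq : 0 < z - b := by linarith
  rw [div_le_iff₀ hd] at hzV
  have hint : Integrable (fun l => 1 / (z - m) + (l - m) / (z - m) ^ 2 + (α - m) / (z - m) ^ 2) μ :=
    ((integrable_const _).add ((hi.sub (integrable_const _)).div_const _)).add (integrable_const _)
  have h := integral_mono_ae (integrable_inv_sub hμ hzb) hint ?_
  · have h1 : Integrable (fun l => l - m) μ := hi.sub (integrable_const m)
    have h2 : Integrable (fun l => 1 / (z - m) + (l - m) / (z - m) ^ 2) μ :=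
      (integrable_const _).add (h1.div_const _)
    rw [integral_add h2 (integrable_const _),
      integral_add (integrable_const _) (h1.div_const _), integral_div _ fun l => l - m,
      integral_sub hi (integrable_const _), ← spectralMean, ← hm_def] at h
    simp only [integral_const, probReal_univ, smul_eq_mul, one_mul, sub_self, zero_div,
      add_zero] at h
    calc (z - α) * hilbertTransform μ z
        ≤ (z - α) * (1 / (z - m) + (α - m) / (z - m) ^ 2) :=
          mul_le_mul_of_nonneg_left h (by linarith)
      _ = 1 - (α - m) ^ 2 / (z - m) ^ 2 := by
          field_simp
          ring
      _ ≤ 1 := by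
          have : 0 ≤ (α - m) ^ 2 / (z - m) ^ 2 := by positivity
          linarith
  · filter_upwards [hμ] with l hl
    have hr : 0 < z - l := by linarith [hl.2]
    have e : 1 / (z - l) = 1 / (z - m) + (l - m) / (z - m) ^ 2
        + (l - m) ^ 2 / (z - l) / (z - m) ^ 2 := by
      field_simp
      ring
    rw [e]
    gcongr
    rw [div_le_iff₀ hr]
    have h2 : (l - m) ^ 2 ≤ V := by
      refine sq_le_sq.2 ?_
      rw [abs_of_nonneg (show 0 ≤ b - a by linarith [hl.1, hl.2]), abs_le]
      constructor <;> linarith [hl.1, hl.2, hm.1, hm.2]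
    have h3 : (α - m) * (z - b) ≤ (α - m) * (z - l) :=
      mul_le_mul_of_nonneg_left (by linarith [hl.2]) hd.le
    linarith

theorem exists_sub_mul_hilbertTransform_eq_one (hμ : ∀ᵐ l ∂μ, l ∈ Icc a b) {α : ℝ}
    (h0 : spectralMean μ < α) (h1 : α < alphaMax μ b) :
    ∃ z, b < z ∧ (z - α) * hilbertTransform μ z = 1 := by
  obtain ⟨x, hx1, hx2⟩ := (((tendsto_alphaMax hμ).eventually_const_lt h1).and
    self_mem_nhdsWithin).exists
  obtain ⟨y, hy1, hy2⟩ := exists_sub_mul_hilbertTransform_le_one hμ h0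
  have hc : ContinuousOn (fun z => z - 1 / hilbertTransform μ z) (Ioi b) :=
    continuousOn_id.sub (continuousOn_const.div (continuousOn_hilbertTransform hμ)
      fun z hz => (hilbertTransform_pos hμ hz).ne')
  obtain ⟨z, hz, hz'⟩ := isPreconnected_Ioi.intermediate_value (a := y) (b := x) hy1 hx2
    hc ⟨(sub_inv_hilbertTransform_le_iff hμ hy1).2 hy2, hx1.le⟩
  exact ⟨z, hz, (sub_inv_hilbertTransform_eq_iff hμ hz).1 hz'⟩

/-! ### The function `h_α` to the right of the support -/

theorem integrable_log_div (hμ : ∀ᵐ l ∂μ, l ∈ Icc a b) {α κ : ℝ} (hα : α ≤ b) (hκ : b < κ) :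
    Integrable (fun l => Real.log ((κ - l) / (κ - α))) μ := by
  refine integrable_of_continuousOn_Icc hμ (ContinuousOn.log (by fun_prop) fun l hl => ?_)
  exact (div_pos (by linarith [hl.2]) (by linarith)).ne'

/-- Integrate `log u ≤ u - 1`, where `u` is the quotient of the arguments of the two logarithms.
This plays the role of the derivative of `h_α`: a point with `(x - α) H(x) = 1` is a global maximum,
and `h_α` decreases wherever `(x - α) H(x) ≤ 1`. -/
theorem hFun_le_hFun_add (hμ : ∀ᵐ l ∂μ, l ∈ Icc a b) {α x y : ℝ} (hα : α ≤ b) (hx : b < x)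
    (hy : b < y) :
    hFun μ α y ≤ hFun μ α x + (y - x) / (y - α) * ((x - α) * hilbertTransform μ x - 1) := by
  have hix := integrable_log_div hμ hα hx
  have hiH : Integrable (fun l => (y - x) / (y - α) * ((x - α) * (1 / (x - l)) - 1)) μ :=
    (((integrable_inv_sub hμ hx).const_mul _).sub (integrable_const _)).const_mul _
  have h := integral_mono_ae (integrable_log_div hμ hα hy) (hix.add hiH) ?_
  · simp only [Pi.add_apply] at h
    rw [integral_add hix hiH, integral_const_mul,
      integral_sub ((integrable_inv_sub hμ hx).const_mul _) (integrable_const _),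
      integral_const_mul] at h
    simpa [hFun, hilbertTransform] using h
  · filter_upwards [hμ] with l hl
    have h1 : 0 < x - l := by linarith [hl.2]
    have h2 : 0 < y - l := by linarith [hl.2]
    have h3 : 0 < x - α := by linarith
    have h4 : 0 < y - α := by linarith
    have h5 := Real.log_le_sub_one_of_pos
      (show 0 < (y - l) / (y - α) / ((x - l) / (x - α)) by positivity)
    rw [Real.log_div (by positivity) (by positivity)] at h5
    have h6 : (y - l) / (y - α) / ((x - l) / (x - α)) - 1
        = (y - x) / (y - α) * ((x - α) * (1 / (x - l)) - 1) := by
      field_simp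
      ring
    simp only [Pi.add_apply]
    linarith

/-- From `log u ≤ u - 1`. It keeps `h_α` bounded near `b` when `α < b`, and gives `h_α ≤ 0` at `α =
m`. -/
theorem hFun_le_div (hμ : ∀ᵐ l ∂μ, l ∈ Icc a b) {α κ : ℝ} (hα : α ≤ b) (hκ : b < κ) :
    hFun μ α κ ≤ (α - spectralMean μ) / (κ - α) := by
  have hi := integrable_id_of_ae_mem_Icc hμ
  have h1 : 0 < κ - α := by linarith
  have hi2 : Integrable (fun l => α - l) μ := (integrable_const α).sub hi
  have h := integral_mono_ae (integrable_log_div hμ hα hκ) (hi2.div_const (κ - α)) ?_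
  · rw [integral_div, integral_sub (integrable_const _) hi] at h
    simpa [hFun, spectralMean] using h
  · filter_upwards [hμ] with l hl
    have h2 : 0 < κ - l := by linarith [hl.2]
    have h3 := Real.log_le_sub_one_of_pos (show 0 < (κ - l) / (κ - α) by positivity)
    have h4 : (κ - l) / (κ - α) - 1 = (α - l) / (κ - α) := by
      field_simp
      ring
    linarith

/-- From `log u ≥ 1 - 1/u`. It makes `h_α` nonnegative wherever `(κ - α) H(κ) ≤ 1`, hence `T ≥ 0`.
-/
theorem one_sub_mul_hilbertTransform_le_hFun (hμ : ∀ᵐ l ∂μ, l ∈ Icc a b) {α κ : ℝ} (hα : α ≤ b)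
    (hκ : b < κ) : 1 - (κ - α) * hilbertTransform μ κ ≤ hFun μ α κ := by
  have h1 : 0 < κ - α := by linarith
  have hi := (integrable_inv_sub hμ hκ).const_mul (κ - α)
  have h := integral_mono_ae ((integrable_const 1).sub hi) (integrable_log_div hμ hα hκ) ?_
  · simp only [Pi.sub_apply] at h
    rw [integral_sub (integrable_const _) hi, integral_const_mul] at h
    simpa [hFun, hilbertTransform] using h
  · filter_upwards [hμ] with l hl
    have h2 : 0 < κ - l := by linarith [hl.2]
    have h3 := Real.one_sub_inv_le_log_of_pos (show 0 < (κ - l) / (κ - α) by positivity)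
    rw [inv_div] at h3
    simpa [div_eq_mul_inv] using h3

theorem antitoneOn_hFun (hμ : ∀ᵐ l ∂μ, l ∈ Icc a b) {α : ℝ} (hα : α ≤ b)
    (h : ∀ κ, b < κ → (κ - α) * hilbertTransform μ κ ≤ 1) : AntitoneOn (hFun μ α) (Ioi b) := by
  intro x hx y hy hxy
  have hx' : b < x := hx
  have hy' : b < y := hy
  have h1 := hFun_le_hFun_add hμ hα hx' hy'
  have h2 : (y - x) / (y - α) * ((x - α) * hilbertTransform μ x - 1) ≤ 0 :=
    mul_nonpos_of_nonneg_of_nonpos (div_nonneg (by linarith) (by linarith))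
      (by linarith [h x hx'])
  linarith

theorem sub_mul_hilbertTransform_le_one_of_alphaMax_le (hμ : ∀ᵐ l ∂μ, l ∈ Icc a b) {α : ℝ}
    (hα : alphaMax μ b ≤ α) {κ : ℝ} (hκ : b < κ) : (κ - α) * hilbertTransform μ κ ≤ 1 :=
  (sub_inv_hilbertTransform_le_iff hμ hκ).1 ((sub_inv_hilbertTransform_le_alphaMax hμ hκ).trans hα)

theorem tendsto_hMax (hμ : ∀ᵐ l ∂μ, l ∈ Icc a b) {α : ℝ} (hα : alphaMax μ b ≤ α) (hαb : α < b) :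
    Tendsto (hFun μ α) (𝓝[>] b) (𝓝 (hMax μ b α)) := by
  have hanti := antitoneOn_hFun hμ hαb.le fun κ hκ =>
    sub_mul_hilbertTransform_le_one_of_alphaMax_le hμ hα hκ
  have hm := (spectralMean_le_alphaMax hμ).trans hα
  refine tendsto_nhds_limUnder ⟨_, hanti.tendsto_nhdsGT
    ⟨(α - spectralMean μ) / (b - α), ?_⟩⟩
  rintro _ ⟨κ, hκ, rfl⟩
  have hκ' : b < κ := hκ
  refine (hFun_le_div hμ hαb.le hκ').trans ?_
  exact div_le_div_of_nonneg_left (by linarith) (by linarith) (by linarith)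

theorem hFun_le_hMax (hμ : ∀ᵐ l ∂μ, l ∈ Icc a b) {α : ℝ} (hα : alphaMax μ b ≤ α) (hαb : α < b)
    {κ : ℝ} (hκ : b < κ) : hFun μ α κ ≤ hMax μ b α := by
  refine ge_of_tendsto (tendsto_hMax hμ hα hαb) ?_
  filter_upwards [Ioo_mem_nhdsGT hκ] with x hx
  exact antitoneOn_hFun hμ hαb.le
    (fun κ hκ => sub_mul_hilbertTransform_le_one_of_alphaMax_le hμ hα hκ) hx.1 hκ hx.2.le

/-- This is why `T(λmax) = +∞` unless `m = λmax`. At `κ = b + (b - a)/w` the argument of the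
logarithm is `1 + w s` with `s = (b - l)/(b - a)` in `[0, 1]`; Bernoulli's inequality gives `log (1
+ w s) ≥ s log (1 + w)`, and `s` has mean `θ > 0`. -/
theorem exists_lt_hFun_right_endpoint (hμ : ∀ᵐ l ∂μ, l ∈ Icc a b) (hm : spectralMean μ < b)
    (C : ℝ) : ∃ κ, b < κ ∧ C < hFun μ b κ := by
  have hab : a < b := (spectralMean_mem_Icc hμ).1.trans_lt hm
  have hi := integrable_id_of_ae_mem_Icc hμ
  have hba : 0 < b - a := by linarith
  set θ := (b - spectralMean μ) / (b - a) with hθ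
  have hθ0 : 0 < θ := div_pos (by linarith) hba
  -- Chosen so that `θ log (1 + w) > C`.
  set w := Real.exp (C / θ) with hw
  have hw0 : 0 < w := Real.exp_pos _
  have hκ : b < b + (b - a) / w := by linarith [div_pos hba hw0]
  refine ⟨b + (b - a) / w, hκ, ?_⟩
  have hi2 : Integrable (fun l => b - l) μ := (integrable_const b).sub hi
  have h := integral_mono_ae ((hi2.div_const (b - a)).mul_const (Real.log (1 + w)))
    (integrable_log_div hμ le_rfl hκ) ?_
  · rw [integral_mul_const, integral_div, integral_sub (integrable_const _) hi] at h
    have h1 : C / θ < Real.log (1 + w) := by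
      rw [Real.lt_log_iff_exp_lt (by positivity)]
      linarith
    rw [div_lt_iff₀' hθ0] at h1
    refine h1.trans_le (le_trans (le_of_eq ?_) h)
    simp [hθ, spectralMean]
  · filter_upwards [hμ] with l hl
    have h0 : 0 ≤ (b - l) / (b - a) := div_nonneg (by linarith [hl.2]) hba.le
    have h1 : (b - l) / (b - a) ≤ 1 := (div_le_one hba).2 (by linarith [hl.1])
    have h2 := rpow_one_add_le_one_add_mul_self (by linarith : -1 ≤ w) h0 h1
    have h3 := Real.log_le_log (by positivity) h2
    rw [Real.log_rpow (by positivity)] at h3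
    refine h3.trans (le_of_eq ?_)
    have h4 := hba.ne'
    rw [add_sub_cancel_left]
    congr 1
    field_simp
    ring

/-- A description of the value `t` at `α` of half of the supremum of `h_α` over `]b, ∞[`. -/
structure IsRightValue (μ : Measure ℝ) (b α t : ℝ) : Prop where
  nonneg : 0 ≤ t
  le : ∀ κ, b < κ → hFun μ α κ ≤ 2 * t
  cases : (∃ κ, b < κ ∧ (κ - α) * hilbertTransform μ κ = 1 ∧ hFun μ α κ = 2 * t) ∨
    ((∀ κ, b < κ → (κ - α) * hilbertTransform μ κ ≤ 1) ∧
      Tendsto (hFun μ α) (𝓝[>] b) (𝓝 (2 * t)))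

theorem isRightValue_of_eq_one (hμ : ∀ᵐ l ∂μ, l ∈ Icc a b) {α κ : ℝ} (hα : α ≤ b) (hκ : b < κ)
    (h : (κ - α) * hilbertTransform μ κ = 1) : IsRightValue μ b α (hFun μ α κ / 2) where
  nonneg := by
    have := one_sub_mul_hilbertTransform_le_hFun hμ hα hκ
    linarith
  le x hx := by
    have := hFun_le_hFun_add hμ hα hκ hx
    rw [h] at this
    linarith
  cases := Or.inl ⟨κ, hκ, h, by ring⟩

theorem isRightValue_hMax (hμ : ∀ᵐ l ∂μ, l ∈ Icc a b) {α : ℝ} (hα : alphaMax μ b ≤ α)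
    (hαb : α < b) : IsRightValue μ b α (hMax μ b α / 2) where
  nonneg := by
    have h1 := one_sub_mul_hilbertTransform_le_hFun hμ hαb.le (lt_add_one b)
    have h2 := sub_mul_hilbertTransform_le_one_of_alphaMax_le hμ hα (lt_add_one b)
    have h3 := hFun_le_hMax hμ hα hαb (lt_add_one b)
    linarith
  le κ hκ := by
    have := hFun_le_hMax hμ hα hαb hκ
    linarith
  cases := by
    refine Or.inr ⟨fun κ hκ => sub_mul_hilbertTransform_le_one_of_alphaMax_le hμ hα hκ, ?_⟩
    rw [mul_div_cancel₀ _ two_ne_zero]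
    exact tendsto_hMax hμ hα hαb

end RightOfSupport

/-- In both cases `2t` is the supremum of `h_α` over `]b, ∞[`: attained at the critical point, or
approached at `b`. -/
theorem IsRightValue.le_iff {μ : Measure ℝ} {b α t c : ℝ} (h : IsRightValue μ b α t) :
    t ≤ c ↔ ∀ κ, b < κ → hFun μ α κ ≤ 2 * c := by
  refine ⟨fun h1 κ hκ => by linarith [h.le κ hκ], fun h1 => ?_⟩
  rcases h.cases with ⟨κ, h2, -, h3⟩ | ⟨-, h2⟩
  · linarith [h1 κ h2]
  · have := le_of_tendsto h2 (by filter_upwards [self_mem_nhdsWithin] with κ hκ using h1 κ hκ)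
    linarith

theorem IsRightValue.unique {μ : Measure ℝ} {b α s t : ℝ} (hs : IsRightValue μ b α s)
    (ht : IsRightValue μ b α t) :
    s = t :=
  le_antisymm (hs.le_iff.2 ht.le) (ht.le_iff.2 hs.le)

/-! ### Reflection at the origin -/

/-- The image of a measure under `x ↦ -x`. -/
noncomputable abbrev reflection (μ : Measure ℝ) : Measure ℝ := μ.map (MeasurableEquiv.neg ℝ)

section Reflection

variable {μ : Measure ℝ} {a b : ℝ}

instance [IsProbabilityMeasure μ] : IsProbabilityMeasure (reflection μ) :=
  Measure.isProbabilityMeasure_map (MeasurableEquiv.neg ℝ).measurable.aemeasurable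

theorem integral_reflection (f : ℝ → ℝ) : ∫ l, f l ∂(reflection μ) = ∫ l, f (-l) ∂μ :=
  integral_map_equiv _ _

theorem ae_reflection_mem_Icc (hμ : ∀ᵐ l ∂μ, l ∈ Icc a b) :
    ∀ᵐ l ∂(reflection μ), l ∈ Icc (-b) (-a) := by
  refine (ae_map_iff (MeasurableEquiv.neg ℝ).measurable.aemeasurable measurableSet_Icc).2 ?_
  filter_upwards [hμ] with l hl
  exact ⟨neg_le_neg hl.2, neg_le_neg hl.1⟩

theorem hilbertTransform_reflection (z : ℝ) :
    hilbertTransform (reflection μ) z = -hilbertTransform μ (-z) := by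
  rw [hilbertTransform, integral_reflection, hilbertTransform, ← integral_neg]
  congr 1
  ext l
  rw [← one_div_neg_eq_neg_one_div]
  congr 1
  ring

theorem spectralMean_reflection : spectralMean (reflection μ) = -spectralMean μ := by
  rw [spectralMean, integral_reflection, spectralMean, integral_neg]

theorem hFun_reflection (α κ : ℝ) : hFun (reflection μ) (-α) (-κ) = hFun μ α κ := by
  rw [hFun, integral_reflection, hFun]
  congr 1
  ext l
  rw [show -κ - -l = -(κ - l) by ring, show -κ - -α = -(κ - α) by ring, neg_div_neg_eq]

variable [IsProbabilityMeasure μ]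

theorem tendsto_hilbertTransform_nhdsLT (hμ : ∀ᵐ l ∂μ, l ∈ Icc a b) :
    Tendsto (fun z => (hilbertTransform μ z : EReal)) (𝓝[<] a)
      (𝓝 (-hilbertMax (reflection μ) (-a))) := by
  have h := (tendsto_hilbertMax (ae_reflection_mem_Icc hμ)).comp tendsto_neg_nhdsLT
  have h2 := (continuous_neg.tendsto _).comp h
  simpa [Function.comp_def, hilbertTransform_reflection] using h2

theorem hilbertMin_eq (hμ : ∀ᵐ l ∂μ, l ∈ Icc a b) :
    hilbertMin μ a = -hilbertMax (reflection μ) (-a) :=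
  (tendsto_hilbertTransform_nhdsLT hμ).limUnder_eq

theorem alphaMin_eq (hμ : ∀ᵐ l ∂μ, l ∈ Icc a b) :
    alphaMin μ a = -alphaMax (reflection μ) (-a) := by
  rw [alphaMin, alphaMax, hilbertMin_eq hμ, EReal.inv_neg, EReal.toReal_neg_eq]
  ring

theorem tendsto_hFun_nhdsLT (hμ : ∀ᵐ l ∂μ, l ∈ Icc a b) {α : ℝ} (hα : α ≤ alphaMin μ a)
    (haα : a < α) : Tendsto (hFun μ α) (𝓝[<] a) (𝓝 (hMax (reflection μ) (-a) (-α))) := by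
  rw [alphaMin_eq hμ, le_neg] at hα
  have h := (tendsto_hMax (ae_reflection_mem_Icc hμ) hα (neg_lt_neg haα)).comp
    tendsto_neg_nhdsLT
  simpa [Function.comp_def, hFun_reflection] using h

theorem hMin_eq (hμ : ∀ᵐ l ∂μ, l ∈ Icc a b) {α : ℝ} (hα : α ≤ alphaMin μ a) (haα : a < α) :
    hMin μ a α = hMax (reflection μ) (-a) (-α) :=
  (tendsto_hFun_nhdsLT hμ hα haα).limUnder_eq

theorem hilbertTransform_neg (hμ : ∀ᵐ l ∂μ, l ∈ Icc a b) {z : ℝ} (hz : z < a) :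
    hilbertTransform μ z < 0 := by
  have := hilbertTransform_pos (ae_reflection_mem_Icc hμ) (neg_lt_neg hz)
  rw [hilbertTransform_reflection, neg_neg] at this
  linarith

theorem hilbertMin_neg (hμ : ∀ᵐ l ∂μ, l ∈ Icc a b) : hilbertMin μ a < 0 := by
  rw [hilbertMin_eq hμ, EReal.neg_lt_comm, neg_zero]
  exact hilbertMax_pos (ae_reflection_mem_Icc hμ)

theorem hilbertMin_lt_hilbertTransform (hμ : ∀ᵐ l ∂μ, l ∈ Icc a b) {z : ℝ} (hz : z < a) :
    hilbertMin μ a < (hilbertTransform μ z : EReal) := by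
  have := hilbertTransform_lt_hilbertMax (ae_reflection_mem_Icc hμ) (neg_lt_neg hz)
  rw [hilbertTransform_reflection, neg_neg, EReal.coe_neg] at this
  rw [hilbertMin_eq hμ]
  exact EReal.neg_lt_comm.1 this

theorem sub_inv_hilbertTransform_le_spectralMean (hμ : ∀ᵐ l ∂μ, l ∈ Icc a b) {z : ℝ}
    (hz : z < a) : z - 1 / hilbertTransform μ z ≤ spectralMean μ := by
  have := spectralMean_le_sub_inv_hilbertTransform (ae_reflection_mem_Icc hμ) (neg_lt_neg hz)
  rw [hilbertTransform_reflection, neg_neg, spectralMean_reflection, one_div_neg_eq_neg_one_div]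
    at this
  linarith

theorem alphaMin_le_spectralMean (hμ : ∀ᵐ l ∂μ, l ∈ Icc a b) :
    alphaMin μ a ≤ spectralMean μ := by
  have := spectralMean_le_alphaMax (ae_reflection_mem_Icc hμ)
  rw [spectralMean_reflection] at this
  rw [alphaMin_eq hμ]
  linarith

theorem le_alphaMin (hμ : ∀ᵐ l ∂μ, l ∈ Icc a b) : a ≤ alphaMin μ a := by
  have := alphaMax_le (ae_reflection_mem_Icc hμ)
  rw [alphaMin_eq hμ]
  linarith

end Reflection

/-! ### The inverse functions `K` and `Q` and the values of the rate function -/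

section Inverses

variable {μ : Measure ℝ} [IsProbabilityMeasure μ] {a b : ℝ}

theorem notMem_Icc_iff {z : ℝ} : z ∈ (Icc a b)ᶜ ↔ z < a ∨ b < z := by
  rw [mem_compl_iff, mem_Icc, not_and_or, not_le, not_le]

theorem injOn_hilbertTransform (hμ : ∀ᵐ l ∂μ, l ∈ Icc a b) :
    InjOn (hilbertTransform μ) (Icc a b)ᶜ := by
  intro x hx y hy hxy
  rw [notMem_Icc_iff] at hx hy
  rcases hx with hx | hx <;> rcases hy with hy | hy
  · have h := (strictAntiOn_hilbertTransform (ae_reflection_mem_Icc hμ)).injOn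
      (neg_lt_neg hx) (neg_lt_neg hy) (by simp [hilbertTransform_reflection, hxy])
    linarith
  · linarith [hilbertTransform_neg hμ hx, hilbertTransform_pos hμ hy]
  · linarith [hilbertTransform_neg hμ hy, hilbertTransform_pos hμ hx]
  · exact (strictAntiOn_hilbertTransform hμ).injOn hx hy hxy

theorem existsUnique_hilbertTransform_eq (hμ : ∀ᵐ l ∂μ, l ∈ Icc a b) {γ : ℝ}
    (hγ : γ ∈ domainK μ a b) : ∃! z, z ∈ (Icc a b)ᶜ ∧ hilbertTransform μ z = γ := by
  refine existsUnique_of_exists_of_unique ?_ fun x y hx hy =>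
    injOn_hilbertTransform hμ hx.1 hy.1 (hx.2.trans hy.2.symm)
  obtain ⟨h1, h2, h3⟩ := hγ
  rcases lt_or_gt_of_ne h3 with h | h
  · rw [hilbertMin_eq hμ, EReal.neg_lt_comm, ← EReal.coe_neg] at h1
    obtain ⟨z, hz, hz'⟩ := exists_hilbertTransform_eq (ae_reflection_mem_Icc hμ) (neg_pos.2 h) h1
    rw [hilbertTransform_reflection, neg_inj] at hz'
    exact ⟨-z, notMem_Icc_iff.2 (Or.inl (by linarith)), hz'⟩
  · obtain ⟨z, hz, hz'⟩ := exists_hilbertTransform_eq hμ h h2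
    exact ⟨z, notMem_Icc_iff.2 (Or.inr hz), hz'⟩

theorem hilbertTransform_mem_domainK (hμ : ∀ᵐ l ∂μ, l ∈ Icc a b) {z : ℝ} (hz : z ∈ (Icc a b)ᶜ) :
    hilbertTransform μ z ∈ domainK μ a b := by
  rcases notMem_Icc_iff.1 hz with hz | hz
  · have h := hilbertTransform_neg hμ hz
    exact ⟨hilbertMin_lt_hilbertTransform hμ hz,
      (EReal.coe_lt_coe_iff.2 h).trans (hilbertMax_pos hμ), h.ne⟩
  · have h := hilbertTransform_pos hμ hz
    exact ⟨(hilbertMin_neg hμ).trans (EReal.coe_lt_coe_iff.2 h),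
      hilbertTransform_lt_hilbertMax hμ hz, h.ne'⟩

theorem kTransform_spec (hμ : ∀ᵐ l ∂μ, l ∈ Icc a b) {γ : ℝ} (hγ : γ ∈ domainK μ a b) :
    kTransform μ a b γ ∈ (Icc a b)ᶜ ∧ hilbertTransform μ (kTransform μ a b γ) = γ := by
  have h : ∃ z ∈ (Icc a b)ᶜ, hilbertTransform μ z = γ :=
    (existsUnique_hilbertTransform_eq hμ hγ).exists
  exact ⟨Function.invFunOn_mem h, Function.invFunOn_eq h⟩

theorem kTransform_hilbertTransform (hμ : ∀ᵐ l ∂μ, l ∈ Icc a b) {z : ℝ} (hz : z ∈ (Icc a b)ᶜ) :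
    kTransform μ a b (hilbertTransform μ z) = z := by
  have h := kTransform_spec hμ (hilbertTransform_mem_domainK hμ hz)
  exact injOn_hilbertTransform hμ h.1 hz h.2

theorem exists_sub_inv_hilbertTransform_eq (hμ : ∀ᵐ l ∂μ, l ∈ Icc a b) {α : ℝ}
    (hα : α ∈ domainQ μ a b) : ∃ z ∈ (Icc a b)ᶜ, z - 1 / hilbertTransform μ z = α := by
  obtain ⟨⟨h1, h2⟩, h3⟩ := hα
  rcases lt_or_gt_of_ne (show α ≠ spectralMean μ from h3) with h | h
  · rw [alphaMin_eq hμ, neg_lt] at h1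
    have hμ' := ae_reflection_mem_Icc hμ
    obtain ⟨z, hz, hz'⟩ := exists_sub_mul_hilbertTransform_eq_one hμ' (α := -α)
      (by rw [spectralMean_reflection]; linarith) h1
    have h4 := (sub_inv_hilbertTransform_eq_iff hμ' hz).2 hz'
    rw [hilbertTransform_reflection, one_div_neg_eq_neg_one_div] at h4
    exact ⟨-z, notMem_Icc_iff.2 (Or.inl (by linarith)), by linarith⟩
  · obtain ⟨z, hz, hz'⟩ := exists_sub_mul_hilbertTransform_eq_one hμ h h2
    exact ⟨z, notMem_Icc_iff.2 (Or.inr hz), (sub_inv_hilbertTransform_eq_iff hμ hz).2 hz'⟩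

/-- The values of `z - 1/H(z)` are at most `m` on the left of the interval and at least `m` on the
right, so for `α ≠ m` two solutions lie on the same side, where single crossing applies. -/
theorem eq_of_sub_inv_hilbertTransform_eq (hμ : ∀ᵐ l ∂μ, l ∈ Icc a b) {α x y : ℝ}
    (hα : α ≠ spectralMean μ) (hx : x ∈ (Icc a b)ᶜ) (hy : y ∈ (Icc a b)ᶜ)
    (hx' : x - 1 / hilbertTransform μ x = α) (hy' : y - 1 / hilbertTransform μ y = α) :
    x = y := by
  have hμ' := ae_reflection_mem_Icc hμ
  rcases notMem_Icc_iff.1 hx with hx | hx <;> rcases notMem_Icc_iff.1 hy with hy | hy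
  · have key : ∀ z, z < a → z - 1 / hilbertTransform μ z = α →
        (-z - -α) * hilbertTransform (reflection μ) (-z) = 1 := fun z hz hz' => by
      refine (sub_inv_hilbertTransform_eq_iff hμ' (neg_lt_neg hz)).1 ?_
      rw [hilbertTransform_reflection, neg_neg, one_div_neg_eq_neg_one_div]
      linarith
    have := eq_of_sub_mul_hilbertTransform_eq_one hμ' (neg_lt_neg hx) (neg_lt_neg hy)
      (key x hx hx') (key y hy hy') (by rw [spectralMean_reflection]; exact neg_injective.ne hα)
    linarith
  · have h1 := sub_inv_hilbertTransform_le_spectralMean hμ hx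
    have h2 := spectralMean_le_sub_inv_hilbertTransform hμ hy
    exact absurd (by linarith) hα
  · have h1 := sub_inv_hilbertTransform_le_spectralMean hμ hy
    have h2 := spectralMean_le_sub_inv_hilbertTransform hμ hx
    exact absurd (by linarith) hα
  · exact eq_of_sub_mul_hilbertTransform_eq_one hμ hx hy
      ((sub_inv_hilbertTransform_eq_iff hμ hx).1 hx')
      ((sub_inv_hilbertTransform_eq_iff hμ hy).1 hy') hα

theorem existsUnique_rTransform_eq (hμ : ∀ᵐ l ∂μ, l ∈ Icc a b) {α : ℝ} (hα : α ∈ domainQ μ a b) :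
    ∃! γ, γ ∈ domainK μ a b ∧ rTransform μ a b γ = α := by
  refine existsUnique_of_exists_of_unique ?_ ?_
  · obtain ⟨z, hz, hz'⟩ := exists_sub_inv_hilbertTransform_eq hμ hα
    exact ⟨_, hilbertTransform_mem_domainK hμ hz, by
      rw [rTransform, kTransform_hilbertTransform hμ hz, hz']⟩
  · rintro γ γ' ⟨h1, h2⟩ ⟨h3, h4⟩
    obtain ⟨k1, k2⟩ := kTransform_spec hμ h1
    obtain ⟨k3, k4⟩ := kTransform_spec hμ h3
    rw [← k2, ← k4, eq_of_sub_inv_hilbertTransform_eq hμ hα.2 k1 k3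
      (by rw [k2]; exact h2) (by rw [k4]; exact h4)]

theorem kTransform_qTransform_spec (hμ : ∀ᵐ l ∂μ, l ∈ Icc a b) {α : ℝ} (hα : α ∈ domainQ μ a b) :
    kTransform μ a b (qTransform μ a b α) ∈ (Icc a b)ᶜ ∧
      kTransform μ a b (qTransform μ a b α)
        - 1 / hilbertTransform μ (kTransform μ a b (qTransform μ a b α)) = α := by
  have h : ∃ γ ∈ domainK μ a b, rTransform μ a b γ = α := (existsUnique_rTransform_eq hμ hα).exists
  have h1 : qTransform μ a b α ∈ domainK μ a b := Function.invFunOn_mem h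
  have h2 : rTransform μ a b (qTransform μ a b α) = α := Function.invFunOn_eq h
  have h3 := kTransform_spec hμ h1
  refine ⟨h3.1, ?_⟩
  rw [h3.2]
  exact h2

/-! ### The values of `T` as suprema of `h_α` -/

theorem rateT_spectralMean (μ : Measure ℝ) (a b : ℝ) : rateT μ a b (spectralMean μ) = 0 :=
  if_pos rfl

theorem exists_rateT_eq_of_spectralMean_lt (hμ : ∀ᵐ l ∂μ, l ∈ Icc a b) {α : ℝ}
    (hm : spectralMean μ < α) (hαb : α < b) :
    ∃ t : ℝ, rateT μ a b α = t ∧ IsRightValue μ b α t := by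
  by_cases hQ : α ∈ domainQ μ a b
  · refine ⟨_, by rw [rateT, if_neg hm.ne', if_pos hQ], ?_⟩
    obtain ⟨h1, h2⟩ := kTransform_qTransform_spec hμ hQ
    rcases notMem_Icc_iff.1 h1 with h3 | h3
    · have := sub_inv_hilbertTransform_le_spectralMean hμ h3
      linarith
    · exact isRightValue_of_eq_one hμ hαb.le h3 ((sub_inv_hilbertTransform_eq_iff hμ h3).1 h2)
  · have h1 : alphaMax μ b ≤ α := by
      by_contra! hcon
      exact hQ ⟨⟨(alphaMin_le_spectralMean hμ).trans_lt hm, hcon⟩, hm.ne'⟩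
    exact ⟨_, by rw [rateT, if_neg hm.ne', if_neg hQ, if_pos ⟨h1, hαb⟩],
      isRightValue_hMax hμ h1 hαb⟩

theorem exists_rateT_eq_of_lt_spectralMean (hμ : ∀ᵐ l ∂μ, l ∈ Icc a b) {α : ℝ}
    (haα : a < α) (hm : α < spectralMean μ) :
    ∃ t : ℝ, rateT μ a b α = t ∧ IsRightValue (reflection μ) (-a) (-α) t := by
  have hμ' := ae_reflection_mem_Icc hμ
  by_cases hQ : α ∈ domainQ μ a b
  · refine ⟨_, by rw [rateT, if_neg hm.ne, if_pos hQ], ?_⟩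
    obtain ⟨h1, h2⟩ := kTransform_qTransform_spec hμ hQ
    rcases notMem_Icc_iff.1 h1 with h3 | h3
    · rw [← hFun_reflection]
      refine isRightValue_of_eq_one hμ' (neg_le_neg haα.le) (neg_lt_neg h3)
        ((sub_inv_hilbertTransform_eq_iff hμ' (neg_lt_neg h3)).1 ?_)
      rw [hilbertTransform_reflection, neg_neg, one_div_neg_eq_neg_one_div]
      linarith
    · have := spectralMean_le_sub_inv_hilbertTransform hμ h3
      linarith
  · have h0 := spectralMean_le_alphaMax hμ
    have h1 : α ≤ alphaMin μ a := by
      by_contra! hcon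
      exact hQ ⟨⟨hcon, by linarith⟩, hm.ne⟩
    have h2 : ¬(alphaMax μ b ≤ α ∧ α < b) := fun h => by linarith [h.1]
    refine ⟨_, by rw [rateT, if_neg hm.ne, if_neg hQ, if_neg h2, if_pos ⟨haα, h1⟩], ?_⟩
    rw [hMin_eq hμ h1 haα]
    exact isRightValue_hMax hμ' (by rwa [← neg_le_neg_iff, neg_neg, ← alphaMin_eq hμ])
      (neg_lt_neg haα)

theorem rateT_eq_top (hμ : ∀ᵐ l ∂μ, l ∈ Icc a b) {α : ℝ} (hm : α ≠ spectralMean μ)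
    (hα : α ∉ Ioo a b) : rateT μ a b α = ⊤ := by
  have h1 := le_alphaMin hμ
  have h2 := alphaMax_le hμ
  have h3 := alphaMin_le_spectralMean hμ
  have h4 := spectralMean_le_alphaMax hμ
  have hQ : α ∉ domainQ μ a b := fun h => hα ⟨h1.trans_lt h.1.1, h.1.2.trans_le h2⟩
  rw [rateT, if_neg hm, if_neg hQ, if_neg, if_neg]
  -- In each of the two one-sided branches the missing strict bound can only fail at the opposite
  -- endpoint, and then `lmin ≤ α_min ≤ m ≤ α_max ≤ lmax` collapses to `α = m`.
  · rintro ⟨h5, h6⟩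
    refine hα ⟨h5, lt_of_le_of_ne (by linarith) fun h => hm (by linarith)⟩
  · rintro ⟨h5, h6⟩
    refine hα ⟨lt_of_le_of_ne (by linarith) fun h => hm (by linarith), h6⟩

theorem rateT_nonneg (hμ : ∀ᵐ l ∂μ, l ∈ Icc a b) (α : ℝ) : 0 ≤ rateT μ a b α := by
  rcases lt_trichotomy α (spectralMean μ) with h | rfl | h
  · rcases lt_or_ge a α with h1 | h1
    · obtain ⟨t, ht, hr⟩ := exists_rateT_eq_of_lt_spectralMean hμ h1 h
      rw [ht]
      exact EReal.coe_nonneg.2 hr.nonneg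
    · rw [rateT_eq_top hμ h.ne fun h2 => absurd h2.1 h1.not_gt]
      exact le_top
  · rw [rateT_spectralMean]
  · rcases lt_or_ge α b with h1 | h1
    · obtain ⟨t, ht, hr⟩ := exists_rateT_eq_of_spectralMean_lt hμ h h1
      rw [ht]
      exact EReal.coe_nonneg.2 hr.nonneg
    · rw [rateT_eq_top hμ h.ne' fun h2 => absurd h2.2 h1.not_gt]
      exact le_top

/-- The supremum formula extends to both endpoints: at `α = m` because `h_α ≤ 0`, and at `α = b > m`
because `h_b` is unbounded. -/
theorem rateT_le_iff (hμ : ∀ᵐ l ∂μ, l ∈ Icc a b) {α c : ℝ} (hc : 0 ≤ c)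
    (hm : spectralMean μ ≤ α) (hαb : α ≤ b) :
    rateT μ a b α ≤ c ↔ ∀ κ, b < κ → hFun μ α κ ≤ 2 * c := by
  rcases eq_or_lt_of_le hm with rfl | hm
  · rw [rateT_spectralMean]
    refine iff_of_true (EReal.coe_nonneg.2 hc) fun κ hκ => ?_
    have := hFun_le_div hμ hαb hκ
    rw [sub_self, zero_div] at this
    linarith
  rcases eq_or_lt_of_le hαb with rfl | hαb
  · rw [rateT_eq_top hμ hm.ne' fun h => lt_irrefl _ h.2]
    refine iff_of_false (fun h => EReal.coe_ne_top c (top_le_iff.1 h)) fun h => ?_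
    obtain ⟨κ, h1, h2⟩ := exists_lt_hFun_right_endpoint hμ hm (2 * c)
    linarith [h κ h1]
  · obtain ⟨t, ht, hr⟩ := exists_rateT_eq_of_spectralMean_lt hμ hm hαb
    rw [ht, EReal.coe_le_coe_iff, hr.le_iff]

theorem rateT_reflection (hμ : ∀ᵐ l ∂μ, l ∈ Icc a b) {α : ℝ} (hm : α ≤ spectralMean μ) :
    rateT (reflection μ) (-b) (-a) (-α) = rateT μ a b α := by
  have hμ' := ae_reflection_mem_Icc hμ
  rcases eq_or_lt_of_le hm with rfl | hm
  · rw [← spectralMean_reflection, rateT_spectralMean, rateT_spectralMean]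
  have hm' : spectralMean (reflection μ) < -α := by
    rw [spectralMean_reflection]
    exact neg_lt_neg hm
  rcases lt_or_ge a α with h | h
  · obtain ⟨s, hs, hs'⟩ := exists_rateT_eq_of_spectralMean_lt hμ' hm' (neg_lt_neg h)
    obtain ⟨t, ht, ht'⟩ := exists_rateT_eq_of_lt_spectralMean hμ h hm
    rw [hs, ht, hs'.unique ht']
  · rw [rateT_eq_top hμ hm.ne fun h1 => absurd h1.1 h.not_gt,
      rateT_eq_top hμ' hm'.ne' fun h1 => absurd h1.2 (neg_le_neg h).not_gt]

/-! ### Compactness of the sublevel sets -/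

theorem continuousOn_hFun_left (hμ : ∀ᵐ l ∂μ, l ∈ Icc a b) {κ : ℝ} (hκ : b < κ) :
    ContinuousOn (fun α => hFun μ α κ) (Iic b) := by
  have h : ∀ α ∈ Iic b, hFun μ α κ = ∫ l, Real.log (κ - l) ∂μ - Real.log (κ - α) := by
    intro α hα
    have hα' : α ≤ b := hα
    have hi : Integrable (fun l => Real.log (κ - l)) μ :=
      integrable_of_continuousOn_Icc hμ (ContinuousOn.log (by fun_prop) fun l hl => by
        linarith [hl.2])
    have : hFun μ α κ = ∫ l, (Real.log (κ - l) - Real.log (κ - α)) ∂μ := by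
      refine integral_congr_ae ?_
      filter_upwards [hμ] with l hl
      have h1 : κ - l ≠ 0 := by linarith [hl.2]
      have h2 : κ - α ≠ 0 := by linarith
      exact Real.log_div h1 h2
    rw [this, integral_sub hi (integrable_const _)]
    simp
  refine ContinuousOn.congr (continuousOn_const.sub (ContinuousOn.log (by fun_prop) ?_)) h
  intro α hα
  have hα' : α ≤ b := hα
  linarith

/-- A supremum is at most `2c` exactly when each `h_α(κ)` is, and for fixed `κ` this is a closed
condition on `α` in the compact interval `[m, b]`. -/
theorem isCompact_sublevel_right (hμ : ∀ᵐ l ∂μ, l ∈ Icc a b) {c : ℝ} (hc : 0 ≤ c) :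
    IsCompact {α | spectralMean μ ≤ α ∧ rateT μ a b α ≤ c} := by
  have e : {α | spectralMean μ ≤ α ∧ rateT μ a b α ≤ c}
      = ⋂ κ ∈ Ioi b, Icc (spectralMean μ) b ∩ (fun α => hFun μ α κ) ⁻¹' Iic (2 * c) := by
    ext α
    simp only [mem_ofPred_eq, mem_iInter, mem_inter_iff, mem_preimage, mem_Iic]
    constructor
    · rintro ⟨h1, h2⟩ κ hκ
      have h3 : α ≤ b := by
        by_contra! h3
        rw [rateT_eq_top hμ ((spectralMean_mem_Icc hμ).2.trans_lt h3).ne'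
          fun h4 => absurd h4.2 h3.le.not_gt] at h2
        exact EReal.coe_ne_top c (top_le_iff.1 h2)
      exact ⟨⟨h1, h3⟩, (rateT_le_iff hμ hc h1 h3).1 h2 κ hκ⟩
    · intro h
      have h1 := (h (b + 1) (lt_add_one b)).1
      exact ⟨h1.1, (rateT_le_iff hμ hc h1.1 h1.2).2 fun κ hκ => (h κ hκ).2⟩
  have hclosed : ∀ κ ∈ Ioi b,
      IsClosed (Icc (spectralMean μ) b ∩ (fun α => hFun μ α κ) ⁻¹' Iic (2 * c)) := fun κ hκ =>
    ((continuousOn_hFun_left hμ hκ).mono fun x hx => hx.2).preimage_isClosed_of_isClosed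
      isClosed_Icc isClosed_Iic
  rw [e]
  refine (isCompact_Icc (a := spectralMean μ) (b := b)).of_isClosed_subset
    (isClosed_biInter hclosed) ?_
  exact (biInter_subset_of_mem (lt_add_one b : b + 1 ∈ Ioi b)).trans inter_subset_left

theorem isCompact_sublevel_rateT (hμ : ∀ᵐ l ∂μ, l ∈ Icc a b) (c : ℝ) :
    IsCompact {α | rateT μ a b α ≤ c} := by
  rcases lt_or_ge c 0 with hc | hc
  · convert! isCompact_empty (X := ℝ)
    refine eq_empty_of_forall_notMem fun α hα => ?_
    have := EReal.coe_nonneg.1 ((rateT_nonneg hμ α).trans hα)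
    linarith
  · have h1 := isCompact_sublevel_right hμ hc
    have h2 := (isCompact_sublevel_right (ae_reflection_mem_Icc hμ) hc).image continuous_neg
    convert! h1.union h2
    ext α
    simp only [mem_ofPred_eq, mem_union, mem_image, spectralMean_reflection]
    constructor
    · intro h
      rcases le_total (spectralMean μ) α with h3 | h3
      · exact Or.inl ⟨h3, h⟩
      · exact Or.inr ⟨-α, ⟨neg_le_neg h3, by rwa [rateT_reflection hμ h3]⟩, neg_neg α⟩
    · rintro (h | ⟨β, ⟨h3, h4⟩, rfl⟩)
      · exact h.2
      · rwa [← rateT_reflection hμ (by linarith), neg_neg]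

theorem isGoodRateFunction_rateT (hμ : ∀ᵐ l ∂μ, l ∈ Icc a b) :
    IsGoodRateFunction (rateT μ a b) where
  nonneg := rateT_nonneg hμ
  isCompact_sublevel := isCompact_sublevel_rateT hμ
  lowerSemicontinuous := by
    rw [lowerSemicontinuous_iff_isClosed_preimage]
    intro y
    induction y using EReal.rec with
    | bot =>
      convert! isClosed_empty (X := ℝ)
      refine eq_empty_of_forall_notMem fun α hα => ?_
      have h1 : rateT μ a b α = ⊥ := le_bot_iff.1 hα
      have h2 := rateT_nonneg hμ α
      rw [h1] at h2
      exact absurd h2 (by simp)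
    | top =>
      convert! isClosed_univ (X := ℝ)
      simp
    | coe c => exact (isCompact_sublevel_rateT hμ c).isClosed

end Inverses
/-! ### Integrals of products and densities of product measures -/

section ProductMeasures

variable {ι : Type*} [Fintype ι]

theorem lintegral_pi_prod (ν : ι → Measure ℝ) [∀ i, IsProbabilityMeasure (ν i)]
    {f : ι → ℝ → ℝ≥0∞} (hf : ∀ i, Measurable (f i)) :
    ∫⁻ x, ∏ i, f i (x i) ∂(Measure.pi ν) = ∏ i, ∫⁻ x, f i x ∂(ν i) := by
  have h := lintegral_prod_eq_prod_lintegral_of_indepFun Finset.univ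
    (fun (i : ι) (x : ι → ℝ) => f i (x i))
    (iIndepFun_pi (μ := ν) (X := f) fun i => (hf i).aemeasurable)
    (fun i => (hf i).comp (measurable_pi_apply i))
  rw [h]
  exact Finset.prod_congr rfl fun i _ => (measurePreserving_eval ν i).lintegral_comp (hf i)

theorem pi_withDensity_eq (ν : ι → Measure ℝ) [∀ i, IsProbabilityMeasure (ν i)]
    {f : ι → ℝ → ℝ≥0∞} (hf : ∀ i, Measurable (f i))
    [∀ i, SigmaFinite ((ν i).withDensity (f i))] :
    Measure.pi (fun i => (ν i).withDensity (f i))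
      = (Measure.pi ν).withDensity fun x => ∏ i, f i (x i) := by
  refine Measure.pi_eq fun s hs => ?_
  have h1 : ∀ x : ι → ℝ, (univ.pi s).indicator (fun x => ∏ i, f i (x i)) x
      = ∏ i, (s i).indicator (f i) (x i) := by
    intro x
    by_cases hx : x ∈ univ.pi s
    · rw [indicator_of_mem hx]
      exact Finset.prod_congr rfl fun i _ => (indicator_of_mem (hx i (mem_univ i)) _).symm
    · rw [indicator_of_notMem hx]
      obtain ⟨i, hi⟩ : ∃ i, x i ∉ s i := by simpa [mem_univ_pi] using hx
      exact (Finset.prod_eq_zero (Finset.mem_univ i) (indicator_of_notMem hi _)).symm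
  rw [withDensity_apply _ (MeasurableSet.univ_pi hs),
    ← lintegral_indicator (MeasurableSet.univ_pi hs), lintegral_congr h1,
    lintegral_pi_prod ν fun i => (hf i).indicator (hs i)]
  exact Finset.prod_congr rfl fun i _ => by
    rw [lintegral_indicator (hs i), withDensity_apply _ (hs i)]

end ProductMeasures

/-! ### Affine changes of variables in the Gaussian measure -/

/-- The log-density of `N(0,1)` with respect to `N(m,σ²)`. -/
noncomputable def gaussianLogDensity (m σ y : ℝ) : ℝ :=
  Real.log σ - y ^ 2 / 2 + (y - m) ^ 2 / (2 * σ ^ 2)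

theorem measurable_gaussianLogDensity (m σ : ℝ) : Measurable (gaussianLogDensity m σ) := by
  unfold gaussianLogDensity
  fun_prop

theorem gaussianReal_eq_withDensity_map (m : ℝ) {σ : ℝ} (hσ : 0 < σ) :
    gaussianReal 0 1 = ((gaussianReal 0 1).map fun x => m + σ * x).withDensity
      fun y => ENNReal.ofReal (Real.exp (gaussianLogDensity m σ y)) := by
  have h1 : (gaussianReal 0 1).map (fun x => m + σ * x)
      = gaussianReal m (NNReal.mk (σ ^ 2) (sq_nonneg σ)) := by
    have := gaussianReal_map_const_add (μ := σ * 0) (v := NNReal.mk (σ ^ 2) (sq_nonneg σ) * 1) m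
    rw [← gaussianReal_map_const_mul, Measure.map_map (by fun_prop) (by fun_prop)] at this
    simpa [Function.comp_def] using this
  have hv : NNReal.mk (σ ^ 2) (sq_nonneg σ) ≠ 0 := by
    intro h
    have : σ ^ 2 = 0 := congrArg NNReal.toReal h
    exact hσ.ne' (pow_eq_zero_iff two_ne_zero |>.1 this)
  rw [h1, gaussianReal_of_var_ne_zero _ hv, gaussianReal_of_var_ne_zero _ one_ne_zero,
    ← withDensity_mul volume (measurable_gaussianPDF m (NNReal.mk (σ ^ 2) (sq_nonneg σ)))
      (measurable_gaussianLogDensity m σ).exp.ennreal_ofReal]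
  congr 1
  ext y
  simp only [Pi.mul_apply, gaussianPDF]
  rw [← ENNReal.ofReal_mul (gaussianPDFReal_nonneg _ _ _)]
  congr 1
  simp only [gaussianPDFReal, gaussianLogDensity, NNReal.coe_mk, NNReal.coe_one]
  rw [Real.exp_add, Real.exp_sub, Real.exp_log hσ,
    Real.sqrt_mul (show (0 : ℝ) ≤ 2 * Real.pi by positivity) (σ ^ 2),
    Real.sqrt_sq hσ.le, mul_one, mul_one, sub_zero, neg_div, neg_div, Real.exp_neg, Real.exp_neg]
  have := Real.exp_pos ((y - m) ^ 2 / (2 * σ ^ 2))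
  have : 0 < √(2 * Real.pi) := Real.sqrt_pos.2 (by positivity)
  field_simp

/-- With `σ² = 1/(1 - 2t)`, the factor `exp (t y²)` cancels the quadratic part of the density of
`N(0,1)` relative to `N(0,σ²)`, leaving the integral of a constant against a probability measure. -/
theorem lintegral_exp_mul_sq_gaussianReal {t : ℝ} (ht : 0 < 1 - 2 * t) :
    ∫⁻ x, ENNReal.ofReal (Real.exp (t * x ^ 2)) ∂(gaussianReal 0 1)
      = ENNReal.ofReal (Real.exp (-(Real.log (1 - 2 * t) / 2))) := by
  set σ := (√(1 - 2 * t))⁻¹ with hσ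
  have hσ0 : 0 < σ := inv_pos.2 (Real.sqrt_pos.2 ht)
  have hσ2 : σ ^ 2 = (1 - 2 * t)⁻¹ := by rw [hσ, inv_pow, Real.sq_sqrt ht.le]
  have hL : ∀ y, gaussianLogDensity 0 σ y = -(Real.log (1 - 2 * t) / 2) - t * y ^ 2 := by
    intro y
    rw [gaussianLogDensity, hσ2, hσ, Real.log_inv, Real.log_sqrt ht.le]
    field_simp
    ring
  rw [gaussianReal_eq_withDensity_map 0 hσ0, lintegral_withDensity_eq_lintegral_mul _
    (measurable_gaussianLogDensity 0 σ).exp.ennreal_ofReal (by fun_prop)]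
  have hm : Measurable fun x : ℝ => 0 + σ * x := by fun_prop
  have := Measure.isProbabilityMeasure_map (μ := gaussianReal 0 1) hm.aemeasurable
  rw [lintegral_congr (g := fun _ => ENNReal.ofReal (Real.exp (-(Real.log (1 - 2 * t) / 2))))]
  · rw [lintegral_const, measure_univ, mul_one]
  · intro y
    simp only [Pi.mul_apply]
    rw [← ENNReal.ofReal_mul (Real.exp_pos _).le, ← Real.exp_add, hL]
    congr 2
    ring

/-- The affine map `ξ ↦ m + σ ξ`, coordinate by coordinate. -/
def affineMap {N : ℕ} (m σ ξ : Fin N → ℝ) : Fin N → ℝ := fun i => m i + σ i * ξ i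

theorem measurable_affineMap {N : ℕ} (m σ : Fin N → ℝ) : Measurable (affineMap m σ) := by
  unfold affineMap
  fun_prop

instance (N : ℕ) : IsProbabilityMeasure (stdGaussianPi N) := by
  unfold stdGaussianPi
  infer_instance

theorem stdGaussianPi_eq_withDensity_map {N : ℕ} (m : Fin N → ℝ) {σ : Fin N → ℝ}
    (hσ : ∀ i, 0 < σ i) :
    stdGaussianPi N = ((stdGaussianPi N).map (affineMap m σ)).withDensity
      fun y => ENNReal.ofReal (Real.exp (∑ i, gaussianLogDensity (m i) (σ i) (y i))) := by
  have hm : ∀ i, Measurable fun x : ℝ => m i + σ i * x := fun i => by fun_prop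
  have hp : ∀ i, IsProbabilityMeasure ((gaussianReal 0 1).map fun x => m i + σ i * x) :=
    fun i => Measure.isProbabilityMeasure_map (hm i).aemeasurable
  have h1 : (stdGaussianPi N).map (affineMap m σ)
      = Measure.pi fun i => (gaussianReal 0 1).map fun x => m i + σ i * x :=
    Measure.pi_map_pi (μ := fun _ => gaussianReal 0 1) fun i => (hm i).aemeasurable
  have h2 : ∀ i, SigmaFinite (((gaussianReal 0 1).map fun x => m i + σ i * x).withDensity
      fun y => ENNReal.ofReal (Real.exp (gaussianLogDensity (m i) (σ i) y))) := fun i => by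
    rw [← gaussianReal_eq_withDensity_map (m i) (hσ i)]
    infer_instance
  have h3 := pi_withDensity_eq (fun i => (gaussianReal 0 1).map fun x => m i + σ i * x)
    (f := fun i y => ENNReal.ofReal (Real.exp (gaussianLogDensity (m i) (σ i) y)))
    fun i => (measurable_gaussianLogDensity _ _).exp.ennreal_ofReal
  rw [h1]
  simp_rw [Real.exp_sum, ENNReal.ofReal_prod_of_nonneg fun _ _ => (Real.exp_pos _).le]
  rw [← h3, stdGaussianPi]
  congr 1
  ext i : 1
  exact gaussianReal_eq_withDensity_map (m i) (hσ i)

/-- The change-of-measure inequality: relative to the law of the affine image, the Gaussian measure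
has density at least `exp c` on the restricted event. -/
theorem exp_mul_stdGaussianPi_le {N : ℕ} (m : Fin N → ℝ) {σ : Fin N → ℝ} (hσ : ∀ i, 0 < σ i)
    {E : Set (Fin N → ℝ)} (hE : MeasurableSet E) (c : ℝ) :
    ENNReal.ofReal (Real.exp c) * stdGaussianPi N {ξ | affineMap m σ ξ ∈ E ∧
      c ≤ ∑ i, gaussianLogDensity (m i) (σ i) (affineMap m σ ξ i)} ≤ stdGaussianPi N E := by
  have hL : Measurable fun y : Fin N → ℝ => ∑ i, gaussianLogDensity (m i) (σ i) (y i) :=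
    Finset.measurable_sum _ fun i _ =>
      (measurable_gaussianLogDensity _ _).comp (measurable_pi_apply i)
  have hF : MeasurableSet {y | y ∈ E ∧ c ≤ ∑ i, gaussianLogDensity (m i) (σ i) (y i)} :=
    hE.inter (hL measurableSet_Ici)
  calc _ = ENNReal.ofReal (Real.exp c) * (stdGaussianPi N).map (affineMap m σ)
        {y | y ∈ E ∧ c ≤ ∑ i, gaussianLogDensity (m i) (σ i) (y i)} := by
        rw [Measure.map_apply (measurable_affineMap m σ) hF]
        rfl
    _ = ∫⁻ _ in {y | y ∈ E ∧ c ≤ ∑ i, gaussianLogDensity (m i) (σ i) (y i)},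
          ENNReal.ofReal (Real.exp c) ∂((stdGaussianPi N).map (affineMap m σ)) := by
        rw [lintegral_const, Measure.restrict_apply_univ]
    _ ≤ ∫⁻ y in {y | y ∈ E ∧ c ≤ ∑ i, gaussianLogDensity (m i) (σ i) (y i)},
          ENNReal.ofReal (Real.exp (∑ i, gaussianLogDensity (m i) (σ i) (y i)))
          ∂((stdGaussianPi N).map (affineMap m σ)) :=
        setLIntegral_mono (hL.exp.ennreal_ofReal) fun y hy =>
          ENNReal.ofReal_le_ofReal (Real.exp_le_exp.2 hy.2)
    _ ≤ ∫⁻ y in E, ENNReal.ofReal (Real.exp (∑ i, gaussianLogDensity (m i) (σ i) (y i)))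
          ∂((stdGaussianPi N).map (affineMap m σ)) := lintegral_mono_set fun y hy => hy.1
    _ = stdGaussianPi N E := by
        conv_rhs => rw [stdGaussianPi_eq_withDensity_map m hσ]
        rw [withDensity_apply _ hE]

/-! ### A weak law of large numbers for quadratic functions of Gaussian variables -/

theorem memLp_quadratic (A B C : ℝ) :
    MemLp (fun x : ℝ => A * x ^ 2 + B * x + C) 2 (gaussianReal 0 1) := by
  have h1 : MemLp (fun x : ℝ => x) 2 (gaussianReal 0 1) := memLp_id_gaussianReal 2
  have h4 : MemLp (fun x : ℝ => x) 4 (gaussianReal 0 1) := memLp_id_gaussianReal 4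
  have h2 : MemLp (fun x : ℝ => x ^ 2) 2 (gaussianReal 0 1) := by
    rw [memLp_two_iff_integrable_sq (by fun_prop)]
    have := h4.integrable_norm_pow (by norm_num)
    refine this.congr (ae_of_all _ fun x => ?_)
    simp only [Real.norm_eq_abs]
    rw [← pow_mul]
    norm_num
    rw [show (4 : ℕ) = 2 * 2 by rfl, pow_mul, sq_abs, ← pow_mul]
  exact ((h2.const_mul A).add (h1.const_mul B)).add (memLp_const C)

theorem integral_sq_gaussianReal : ∫ x, x ^ 2 ∂(gaussianReal 0 1) = 1 := by
  have h := variance_fun_id_gaussianReal (μ := 0) (v := 1)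
  rw [variance_of_integral_eq_zero (by fun_prop) (by simp)] at h
  simpa using h

theorem integral_quadratic (A B C : ℝ) :
    ∫ x, (A * x ^ 2 + B * x + C) ∂(gaussianReal 0 1) = A + C := by
  have h2 : Integrable (fun x : ℝ => A * x ^ 2) (gaussianReal 0 1) := by
    simpa using (memLp_quadratic A 0 0).integrable (by norm_num)
  have h1 : Integrable (fun x : ℝ => B * x) (gaussianReal 0 1) := by
    simpa using (memLp_quadratic 0 B 0).integrable (by norm_num)
  have h12 : Integrable (fun x : ℝ => A * x ^ 2 + B * x) (gaussianReal 0 1) := h2.add h1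
  rw [integral_add h12 (integrable_const _), integral_add h2 h1, integral_const_mul,
    integral_const_mul, integral_sq_gaussianReal]
  simp

theorem exists_variance_quadratic_le : ∃ K : ℝ, 0 ≤ K ∧ ∀ A B C : ℝ,
    Var[fun x : ℝ => A * x ^ 2 + B * x + C; gaussianReal 0 1] ≤ K * (A ^ 2 + B ^ 2) := by
  have h4 : Integrable (fun x : ℝ => x ^ 4) (gaussianReal 0 1) := by
    refine ((memLp_quadratic 1 0 0).integrable_sq).congr (ae_of_all _ fun x => ?_)
    simp only
    ring
  have h2 : Integrable (fun x : ℝ => x ^ 2) (gaussianReal 0 1) := by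
    refine ((memLp_quadratic 0 1 0).integrable_sq).congr (ae_of_all _ fun x => ?_)
    simp only
    ring
  have hnn : 0 ≤ ∫ x, x ^ 4 ∂(gaussianReal 0 1) := integral_nonneg fun x => by positivity
  refine ⟨2 * ((∫ x, x ^ 4 ∂(gaussianReal 0 1)) + 1), by linarith, fun A B C => ?_⟩
  have hint : Integrable (fun x : ℝ => 2 * A ^ 2 * x ^ 4 + 2 * B ^ 2 * x ^ 2) (gaussianReal 0 1) :=
    (h4.const_mul _).add (h2.const_mul _)
  rw [variance_add_const (by fun_prop)]
  calc Var[fun x : ℝ => A * x ^ 2 + B * x; gaussianReal 0 1]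
      ≤ ∫ x, (A * x ^ 2 + B * x) ^ 2 ∂(gaussianReal 0 1) :=
        variance_le_expectation_sq (by fun_prop)
    _ ≤ ∫ x, (2 * A ^ 2 * x ^ 4 + 2 * B ^ 2 * x ^ 2) ∂(gaussianReal 0 1) := by
        refine integral_mono_of_nonneg (ae_of_all _ fun x => sq_nonneg _) hint
          (ae_of_all _ fun x => ?_)
        simp only
        nlinarith [sq_nonneg (A * x ^ 2 - B * x)]
    _ = 2 * A ^ 2 * (∫ x, x ^ 4 ∂(gaussianReal 0 1)) + 2 * B ^ 2 := by
        rw [integral_add (h4.const_mul _) (h2.const_mul _), integral_const_mul,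
          integral_const_mul, integral_sq_gaussianReal, mul_one]
    _ ≤ _ := by nlinarith [sq_nonneg A, mul_nonneg (sq_nonneg B) hnn]

/-- Chebyshev's inequality for independent summands: the variance of the sum is `O(N)`, so the
probability is `O(1/N)`. Half of `δ` absorbs the error in the mean and the other half the
fluctuation. -/
theorem tendsto_stdGaussianPi_deviation {A B C : (N : ℕ) → Fin N → ℝ} {ℓ M : ℝ}
    (hmean : Tendsto (fun N : ℕ => (N : ℝ)⁻¹ * ∑ i, (A N i + C N i)) atTop (𝓝 ℓ))
    (hvar : ∀ᶠ N : ℕ in atTop, ∑ i, (A N i ^ 2 + B N i ^ 2) ≤ M * N) {δ : ℝ} (hδ : 0 < δ) :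
    Tendsto (fun N : ℕ => stdGaussianPi N {ξ | δ ≤
      |(N : ℝ)⁻¹ * ∑ i, (A N i * ξ i ^ 2 + B N i * ξ i + C N i) - ℓ|}) atTop (𝓝 0) := by
  obtain ⟨K, hK0, hK⟩ := exists_variance_quadratic_le
  have hlim : Tendsto (fun N : ℕ => ENNReal.ofReal (4 * K * M / δ ^ 2 / N)) atTop (𝓝 0) := by
    rw [← ENNReal.ofReal_zero]
    exact ENNReal.tendsto_ofReal (tendsto_const_nhds.div_atTop tendsto_natCast_atTop_atTop)
  refine tendsto_of_tendsto_of_tendsto_of_le_of_le' tendsto_const_nhds hlim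
    (Eventually.of_forall fun _ => zero_le) ?_
  filter_upwards [hvar, eventually_gt_atTop 0,
    hmean.eventually (Metric.ball_mem_nhds ℓ (half_pos hδ))] with N hv hN hm
  rw [Real.dist_eq] at hm
  have hN' : (0 : ℝ) < N := Nat.cast_pos.2 hN
  set X : Fin N → ℝ → ℝ := fun i x => A N i * x ^ 2 + B N i * x + C N i
  have hX : ∀ i, MemLp (X i) 2 (gaussianReal 0 1) := fun i => memLp_quadratic _ _ _
  have hXi : ∀ i, MemLp (fun ξ : Fin N → ℝ => X i (ξ i)) 2 (stdGaussianPi N) := fun i =>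
    (hX i).comp_measurePreserving (measurePreserving_eval (fun _ => gaussianReal 0 1) i)
  have hS : MemLp (∑ i, fun ξ : Fin N → ℝ => X i (ξ i)) 2 (stdGaussianPi N) :=
    memLp_finsetSum' _ fun i _ => hXi i
  have hSE : ∫ ξ, (∑ i, fun ξ : Fin N → ℝ => X i (ξ i)) ξ ∂(stdGaussianPi N)
      = ∑ i, (A N i + C N i) := by
    simp only [Finset.sum_apply]
    rw [integral_finsetSum _ fun i _ => (hXi i).integrable (by norm_num)]
    refine Finset.sum_congr rfl fun i _ => ?_
    rw [← integral_quadratic (A N i) (B N i) (C N i)]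
    exact integral_comp_eval (μ := fun _ : Fin N => gaussianReal 0 1) (i := i)
      (hX i).aestronglyMeasurable
  have hSV : Var[∑ i, fun ξ : Fin N → ℝ => X i (ξ i); stdGaussianPi N] ≤ K * (M * N) := by
    rw [stdGaussianPi, variance_sum_pi hX]
    calc ∑ i, Var[X i; gaussianReal 0 1] ≤ ∑ i, K * (A N i ^ 2 + B N i ^ 2) :=
          Finset.sum_le_sum fun i _ => hK _ _ _
      _ ≤ K * (M * N) := by
          rw [← Finset.mul_sum]
          exact mul_le_mul_of_nonneg_left hv hK0
  have hch := meas_ge_le_variance_div_sq hS (c := δ / 2 * N) (by positivity)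
  rw [hSE] at hch
  refine (measure_mono fun ξ hξ => ?_).trans (hch.trans (ENNReal.ofReal_le_ofReal ?_))
  · have hξ' : δ ≤ |(N : ℝ)⁻¹ * ∑ i, X i (ξ i) - ℓ| := hξ
    show δ / 2 * N ≤ |(∑ i, fun ξ : Fin N → ℝ => X i (ξ i)) ξ - ∑ i, (A N i + C N i)|
    rw [Finset.sum_apply]
    have h1 := abs_sub_le ((N : ℝ)⁻¹ * ∑ i, X i (ξ i)) ((N : ℝ)⁻¹ * ∑ i, (A N i + C N i)) ℓ
    rw [← mul_sub, abs_mul, abs_of_pos (inv_pos.2 hN')] at h1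
    have h2 : δ / 2 ≤ (N : ℝ)⁻¹ * |∑ i, X i (ξ i) - ∑ i, (A N i + C N i)| := by linarith
    rwa [inv_mul_eq_div, le_div_iff₀ hN'] at h2
  · calc _ ≤ K * (M * N) / (δ / 2 * N) ^ 2 := by gcongr
      _ = 4 * K * M / δ ^ 2 / N := by
        field_simp
        norm_num

/-! ### Convergence of the empirical measures -/

section Spectral

theorem integral_empMeasure {N : ℕ} (x : Fin N → ℝ) (f : ℝ → ℝ) :
    ∫ l, f l ∂(empMeasure x) = (N : ℝ)⁻¹ * ∑ i, f (x i) := by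
  rw [empMeasure, integral_smul_measure, integral_finsetSum_measure fun i _ => by
    exact integrable_dirac (by simp)]
  simp

variable {lam : (N : ℕ) → Fin N → ℝ} {μ : Measure ℝ} {lmin lmax : ℝ}

theorem SpectralHypothesis.eventually_mem_Icc (hyp : SpectralHypothesis lam μ lmin lmax)
    {c d : ℝ} (hc : c < lmin) (hd : lmax < d) : ∀ᶠ N in atTop, ∀ i, lam N i ∈ Icc c d := by
  filter_upwards [hyp.tendsto_min.eventually_const_lt hc, hyp.tendsto_max.eventually_lt_const hd]
    with N h1 h2 i
  exact ⟨h1.le.trans (ciInf_le (Set.finite_range _).bddBelow i),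
    (le_ciSup (Set.finite_range _).bddAbove i).trans h2.le⟩

theorem SpectralHypothesis.reflect (hyp : SpectralHypothesis lam μ lmin lmax) :
    SpectralHypothesis (fun N i => -lam N i) (reflection μ) (-lmax) (-lmin) where
  isCompact_support := by
    have hK : IsCompact (Neg.neg '' μ.support) := hyp.isCompact_support.image continuous_neg
    refine hK.of_isClosed_subset Measure.isClosed_support
      (Measure.support_subset_of_isClosed hK.isClosed ?_)
    refine (ae_map_iff (MeasurableEquiv.neg ℝ).measurable.aemeasurable hK.measurableSet).2 ?_
    filter_upwards [Measure.support_mem_ae (μ := μ)] with l hl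
    exact ⟨l, hl, rfl⟩
  tendsto_empMeasure f := by
    have h := hyp.tendsto_empMeasure (f.compContinuous ⟨fun x => -x, continuous_neg⟩)
    rw [integral_reflection]
    simpa [integral_empMeasure] using h
  tendsto_min := by
    have h : ∀ N, ⨅ i, -lam N i = -⨆ i, lam N i := fun N => by
      rw [iInf, Real.sInf_def, ← image_neg_eq_neg, ← range_comp]
      simp [Function.comp_def, iSup]
    simpa only [h] using hyp.tendsto_max.neg
  tendsto_max := by
    have h : ∀ N, ⨆ i, -lam N i = -⨅ i, lam N i := fun N => by
      rw [iInf, Real.sInf_def, ← image_neg_eq_neg, ← range_comp, neg_neg]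
      rfl
    simpa only [h] using hyp.tendsto_min.neg

variable [IsProbabilityMeasure μ]

/-- Test against `min 1 (max 0 (l - lmax))`: its empirical averages are at most the positive part of
`max_i λ_i - lmax`, which tends to zero. -/
theorem SpectralHypothesis.ae_le (hyp : SpectralHypothesis lam μ lmin lmax) :
    ∀ᵐ l ∂μ, l ≤ lmax := by
  set f : ℝ →ᵇ ℝ := BoundedContinuousFunction.mkOfBound
    ⟨fun l => min 1 (max 0 (l - lmax)), by fun_prop⟩ 1 (fun x y => by
      have h : ∀ z : ℝ, 0 ≤ min 1 (max 0 z) ∧ min 1 (max 0 z) ≤ 1 := fun z =>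
        ⟨le_min zero_le_one (le_max_left _ _), min_le_left _ _⟩
      exact Real.dist_le_of_mem_Icc_01 ⟨(h _).1, (h _).2⟩ ⟨(h _).1, (h _).2⟩) with hf
  have hfx : ∀ x, f x = min 1 (max 0 (x - lmax)) := fun x => rfl
  have hf0 : ∀ x, 0 ≤ f x := fun x => le_min zero_le_one (le_max_left _ _)
  have h1 := hyp.tendsto_empMeasure f
  have h2 : Tendsto (fun N => max 0 ((⨆ i, lam N i) - lmax)) atTop (𝓝 0) := by
    have := (tendsto_const_nhds (x := (0 : ℝ))).max (hyp.tendsto_max.sub_const lmax)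
    simpa using this
  have h3 : ∫ l, f l ∂μ = 0 := by
    refine tendsto_nhds_unique h1 (squeeze_zero (fun N => integral_nonneg hf0) (fun N => ?_) h2)
    rw [integral_empMeasure]
    have hb : ∀ i, f (lam N i) ≤ max 0 ((⨆ i, lam N i) - lmax) := fun i => by
      rw [hfx]
      refine (min_le_right _ _).trans (max_le_max le_rfl ?_)
      exact sub_le_sub_right (le_ciSup (Set.finite_range _).bddAbove i) _
    have hs := Finset.sum_le_card_nsmul Finset.univ _ _ fun i _ => hb i
    rw [Finset.card_univ, Fintype.card_fin, nsmul_eq_mul] at hs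
    rcases Nat.eq_zero_or_pos N with rfl | hN
    · simp
    · rw [inv_mul_le_iff₀ (Nat.cast_pos.2 hN)]
      exact hs
  have h4 := (integral_eq_zero_iff_of_nonneg hf0 (f.integrable μ)).1 h3
  filter_upwards [h4] with l hl
  by_contra! hcon
  have : 0 < f l := by
    rw [hfx]
    exact lt_min one_pos (lt_max_of_lt_right (sub_pos.2 hcon))
  rw [hl] at this
  exact lt_irrefl _ this

theorem SpectralHypothesis.ae_mem_Icc (hyp : SpectralHypothesis lam μ lmin lmax) :
    ∀ᵐ l ∂μ, l ∈ Icc lmin lmax := by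
  have h := hyp.reflect.ae_le
  have h1 := (ae_map_iff (MeasurableEquiv.neg ℝ).measurable.aemeasurable measurableSet_Iic).1 h
  filter_upwards [hyp.ae_le, h1] with l hl hl'
  exact ⟨neg_le_neg_iff.1 hl', hl⟩

/-- Only continuity near `[lmin, lmax]` matters: eventually all entries lie in `[c, d]`, so `f` may
be replaced by its constant extension outside, which is bounded and continuous. -/
theorem SpectralHypothesis.tendsto_average (hyp : SpectralHypothesis lam μ lmin lmax)
    {c d : ℝ} (hc : c < lmin) (hd : lmax < d) {f : ℝ → ℝ} (hf : ContinuousOn f (Icc c d)) :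
    Tendsto (fun N : ℕ => (N : ℝ)⁻¹ * ∑ i, f (lam N i)) atTop (𝓝 (∫ l, f l ∂μ)) := by
  have hlm := left_le_right_of_ae_mem_Icc hyp.ae_mem_Icc
  have hcd : c ≤ d := by linarith
  obtain ⟨C, hC⟩ := isCompact_Icc.exists_bound_of_continuousOn hf
  set g : ℝ →ᵇ ℝ := BoundedContinuousFunction.ofNormedAddCommGroup
    (IccExtend hcd ((Icc c d).domRestrict f)) (hf.domRestrict.Icc_extend') C fun x => by
      rw [IccExtend_apply]
      exact hC _ (projIcc c d hcd x).2
  have hg : ∀ x ∈ Icc c d, g x = f x := fun x hx =>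
    IccExtend_of_mem hcd ((Icc c d).domRestrict f) hx
  have h := hyp.tendsto_empMeasure g
  have h1 : ∫ l, g l ∂μ = ∫ l, f l ∂μ := by
    refine integral_congr_ae ?_
    filter_upwards [hyp.ae_mem_Icc] with l hl
    exact hg l ⟨hc.le.trans hl.1, hl.2.trans hd.le⟩
  rw [h1] at h
  refine h.congr' ?_
  filter_upwards [hyp.eventually_mem_Icc hc hd] with N hN
  rw [integral_empMeasure]
  congr 1
  exact Finset.sum_congr rfl fun i _ => hg _ (hN i)

end Spectral

/-! ### The Rayleigh ratio -/

theorem measurable_rayleighRatio {N : ℕ} (x : Fin N → ℝ) : Measurable (rayleighRatio x) := by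
  unfold rayleighRatio
  fun_prop

theorem rayleighLaw_apply (lam : (N : ℕ) → Fin N → ℝ) (N : ℕ) {E : Set ℝ} (hE : MeasurableSet E) :
    rayleighLaw lam N E = stdGaussianPi N (rayleighRatio (lam N) ⁻¹' E) :=
  Measure.map_apply (measurable_rayleighRatio _) hE

theorem rayleighLaw_le_one (lam : (N : ℕ) → Fin N → ℝ) (N : ℕ) (E : Set ℝ) :
    rayleighLaw lam N E ≤ 1 := by
  have := Measure.isProbabilityMeasure_map (μ := stdGaussianPi N)
    (measurable_rayleighRatio (lam N)).aemeasurable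
  exact prob_le_one (μ := (stdGaussianPi N).map (rayleighRatio (lam N)))

theorem rayleighRatio_neg {N : ℕ} (x g : Fin N → ℝ) :
    rayleighRatio (fun i => -x i) g = -rayleighRatio x g := by
  simp [rayleighRatio, neg_div]

theorem rayleighLaw_reflect (lam : (N : ℕ) → Fin N → ℝ) (N : ℕ) {E : Set ℝ}
    (hE : MeasurableSet E) :
    rayleighLaw (fun N i => -lam N i) N E = rayleighLaw lam N (Neg.neg ⁻¹' E) := by
  rw [rayleighLaw_apply _ _ hE, rayleighLaw_apply _ _ (measurable_neg hE)]
  congr 1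
  ext g
  simp [rayleighRatio_neg]

theorem sum_sub_mul_sq_nonneg_of_le_rayleighRatio {N : ℕ} {x g : Fin N → ℝ} {α : ℝ}
    (h : α ≤ rayleighRatio x g) : 0 ≤ ∑ i, (x i - α) * g i ^ 2 := by
  have h0 : 0 ≤ ∑ i, g i ^ 2 := Finset.sum_nonneg fun i _ => sq_nonneg _
  -- If `g = 0` the ratio has the default value `0/0 = 0`, but the sum vanishes anyway.
  rcases eq_or_lt_of_le h0 with h1 | h1
  · refine (Finset.sum_eq_zero fun i _ => ?_).ge
    rw [(Finset.sum_eq_zero_iff_of_nonneg fun i _ => sq_nonneg (g i)).1 h1.symm i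
      (Finset.mem_univ i), mul_zero]
  · rw [rayleighRatio, le_div_iff₀ h1] at h
    simp_rw [sub_mul]
    rw [Finset.sum_sub_distrib, ← Finset.mul_sum]
    linarith

/-- The Chernoff bound for the Rayleigh ratio. -/
theorem rayleighLaw_Ici_le {lam : (N : ℕ) → Fin N → ℝ} {N : ℕ} {α κ : ℝ} (hα : α < κ)
    (h : ∀ i, lam N i < κ) : rayleighLaw lam N (Ici α)
      ≤ ENNReal.ofReal (Real.exp (-(∑ i, Real.log ((κ - lam N i) / (κ - α)) / 2))) := by
  have hκ : 0 < κ - α := sub_pos.2 hα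
  -- The Chernoff parameter is `1/(2(κ - α))`, so that `1 - 2 t_i` is the argument of the logarithm
  -- in `h_α(κ)`.
  set t : Fin N → ℝ := fun i => (lam N i - α) / (2 * (κ - α)) with ht
  have ht' : ∀ i, 1 - 2 * t i = (κ - lam N i) / (κ - α) := fun i => by
    simp only [ht]
    field_simp
    ring
  rw [rayleighLaw_apply _ _ measurableSet_Ici]
  calc stdGaussianPi N (rayleighRatio (lam N) ⁻¹' Ici α)
      ≤ stdGaussianPi N
          {g | 1 ≤ ∏ i, ENNReal.ofReal (Real.exp (t i * g i ^ 2))} := by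
        refine measure_mono fun g hg => ?_
        have h1 := sum_sub_mul_sq_nonneg_of_le_rayleighRatio (α := α) hg
        simp only [mem_ofPred_eq]
        rw [← ENNReal.ofReal_prod_of_nonneg fun _ _ => (Real.exp_pos _).le, ← Real.exp_sum,
          ENNReal.one_le_ofReal, Real.one_le_exp_iff]
        have : ∑ i, t i * g i ^ 2 = (∑ i, (lam N i - α) * g i ^ 2) / (2 * (κ - α)) := by
          rw [Finset.sum_div]
          exact Finset.sum_congr rfl fun i _ => by simp only [ht]; ring
        rw [this]
        positivity
    _ ≤ ∫⁻ g, ∏ i, ENNReal.ofReal (Real.exp (t i * g i ^ 2)) ∂(stdGaussianPi N) := by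
        have := mul_meas_ge_le_lintegral (μ := stdGaussianPi N)
          (f := fun g => ∏ i, ENNReal.ofReal (Real.exp (t i * g i ^ 2))) (by fun_prop) 1
        rwa [one_mul] at this
    _ = ∏ i, ENNReal.ofReal (Real.exp (-(Real.log ((κ - lam N i) / (κ - α)) / 2))) := by
        rw [stdGaussianPi, lintegral_pi_prod (fun _ : Fin N => gaussianReal 0 1)
          (f := fun i x => ENNReal.ofReal (Real.exp (t i * x ^ 2))) fun i => by fun_prop]
        refine Finset.prod_congr rfl fun i _ => ?_
        rw [lintegral_exp_mul_sq_gaussianReal, ht']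
        rw [ht']
        exact div_pos (sub_pos.2 (h i)) hκ
    _ = _ := by
        rw [← ENNReal.ofReal_prod_of_nonneg fun _ _ => (Real.exp_pos _).le, ← Real.exp_sum,
          Finset.sum_neg_distrib]

open ExpGrowth in
theorem expGrowthSup_rayleighLaw_Ici_le {lam : (N : ℕ) → Fin N → ℝ} {μ : Measure ℝ}
    [IsProbabilityMeasure μ] {lmin lmax : ℝ} (hyp : SpectralHypothesis lam μ lmin lmax)
    {α κ : ℝ} (hα : α ≤ lmax) (hκ : lmax < κ) :
    expGrowthSup (fun N => rayleighLaw lam N (Ici α)) ≤ ((-(hFun μ α κ / 2) : ℝ) : EReal) := by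
  -- Room between `lmax` and `κ`: the logarithm is continuous on an interval that eventually
  -- contains every entry.
  obtain ⟨d, hd, hdκ⟩ := exists_between hκ
  have hf : ContinuousOn (fun l => Real.log ((κ - l) / (κ - α))) (Icc (lmin - 1) d) :=
    ContinuousOn.log (by fun_prop) fun l hl =>
      (div_pos (by linarith [hl.2]) (by linarith)).ne'
  have hlim := hyp.tendsto_average (sub_one_lt lmin) hd hf
  have hlim2 := EReal.tendsto_coe.2 (hlim.div_const 2).neg
  refine le_trans (limsup_le_limsup ?_) hlim2.limsup_eq.le
  filter_upwards [hyp.eventually_mem_Icc (sub_one_lt lmin) hd, eventually_gt_atTop 0] with N h1 h2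
  have h3 := rayleighLaw_Ici_le (lam := lam) (N := N) (α := α) (κ := κ) (by linarith)
    fun i => (h1 i).2.trans_lt hdκ
  have h4 := ENNReal.log_monotone h3
  rw [ENNReal.log_ofReal_of_pos (Real.exp_pos _), Real.log_exp] at h4
  have hN : (0 : ℝ) < N := Nat.cast_pos.2 h2
  rw [EReal.div_le_iff_le_mul (by exact_mod_cast hN) (EReal.natCast_ne_top N)]
  refine h4.trans (le_of_eq ?_)
  rw [← EReal.coe_coe_eq_natCast, ← EReal.coe_mul, ← Finset.sum_div]
  congr 1
  field_simp

/-! ### The lower bound by a change of measure -/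

section LowerBound

open ExpGrowth

variable {lam : (N : ℕ) → Fin N → ℝ} {μ : Measure ℝ} [IsProbabilityMeasure μ] {lmin lmax : ℝ}

/-- One law of large numbers serving three averages in the lower bound: `∑ (λ_i - α) g_i²`, `∑ g_i²`
and the log-density, for `g_i = m_i + √(v(λ_i)) ξ_i`. The shift acts as an atom of mass `w` at
`lmax`. -/
theorem tendsto_stdGaussianPi_spectral_deviation (hyp : SpectralHypothesis lam μ lmin lmax)
    {c d : ℝ} (hc : c < lmin) (hd : lmax < d) {p q r : ℝ → ℝ} (hp : ContinuousOn p (Icc c d))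
    (hq : ContinuousOn q (Icc c d)) (hr : ContinuousOn r (Icc c d)) (β γ : ℝ) {w : ℝ}
    {m : (N : ℕ) → Fin N → ℝ} (hm : ∀ᶠ N : ℕ in atTop, ∑ i, m N i ^ 2 = N * w ∧
      ∑ i, lam N i * m N i ^ 2 = (⨆ i, lam N i) * (N * w)) {δ : ℝ} (hδ : 0 < δ) :
    Tendsto (fun N : ℕ => stdGaussianPi N {ξ | δ ≤
      |(N : ℝ)⁻¹ * ∑ i, (p (lam N i) * ξ i ^ 2 + q (lam N i) * m N i * ξ i
          + (r (lam N i) + (β * lam N i + γ) * m N i ^ 2))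
        - (∫ l, p l ∂μ + ∫ l, r l ∂μ + (β * lmax + γ) * w)|}) atTop (𝓝 0) := by
  obtain ⟨P, hP⟩ := isCompact_Icc.exists_bound_of_continuousOn hp
  obtain ⟨Q, hQ⟩ := isCompact_Icc.exists_bound_of_continuousOn hq
  refine tendsto_stdGaussianPi_deviation (A := fun N i => p (lam N i))
    (B := fun N i => q (lam N i) * m N i)
    (C := fun N i => r (lam N i) + (β * lam N i + γ) * m N i ^ 2) (M := P ^ 2 + Q ^ 2 * w) ?_ ?_ hδ
  · have h := ((hyp.tendsto_average hc hd hp).add (hyp.tendsto_average hc hd hr)).add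
      (((hyp.tendsto_max.const_mul β).add_const γ).mul_const w)
    refine h.congr' ?_
    filter_upwards [hm, eventually_gt_atTop 0] with N ⟨h1, h2⟩ hN
    have hN' : (N : ℝ) ≠ 0 := Nat.cast_ne_zero.2 hN.ne'
    have h3 : ∑ i, (β * lam N i + γ) * m N i ^ 2 = (β * (⨆ i, lam N i) + γ) * (N * w) := by
      simp_rw [add_mul, mul_assoc]
      rw [Finset.sum_add_distrib, ← Finset.mul_sum, ← Finset.mul_sum, h1, h2]
    rw [Finset.sum_add_distrib, Finset.sum_add_distrib, h3]
    field_simp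
    ring
  · filter_upwards [hm, hyp.eventually_mem_Icc hc hd] with N ⟨h1, _⟩ h2
    calc ∑ i, (p (lam N i) ^ 2 + (q (lam N i) * m N i) ^ 2)
        ≤ ∑ i, (P ^ 2 + Q ^ 2 * m N i ^ 2) := by
          refine Finset.sum_le_sum fun i _ => ?_
          rw [mul_pow]
          gcongr ?_ + ?_ * _
          · exact sq_le_sq' (abs_le.1 (hP _ (h2 i))).1 (abs_le.1 (hP _ (h2 i))).2
          · exact sq_le_sq' (abs_le.1 (hQ _ (h2 i))).1 (abs_le.1 (hQ _ (h2 i))).2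
      _ = (P ^ 2 + Q ^ 2 * w) * N := by
          rw [Finset.sum_add_distrib, ← Finset.mul_sum, h1]
          simp
          ring

/-- Put `√(N w)` in one coordinate carrying the largest entry: a single coordinate then contributes
at order `N`. -/
theorem exists_shift_at_max (lam : (N : ℕ) → Fin N → ℝ) {w : ℝ} (hw : 0 ≤ w) :
    ∃ m : (N : ℕ) → Fin N → ℝ, ∀ N : ℕ, 0 < N → ∑ i, m N i ^ 2 = N * w ∧
      ∑ i, lam N i * m N i ^ 2 = (⨆ i, lam N i) * (N * w) := by
  have h : ∀ N : ℕ, ∃ m : Fin N → ℝ, 0 < N → ∑ i, m i ^ 2 = N * w ∧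
      ∑ i, lam N i * m i ^ 2 = (⨆ i, lam N i) * (N * w) := by
    intro N
    rcases Nat.eq_zero_or_pos N with rfl | hN
    · exact ⟨0, fun h => absurd h (lt_irrefl 0)⟩
    have : Nonempty (Fin N) := ⟨⟨0, hN⟩⟩
    obtain ⟨j, hj⟩ := exists_eq_ciSup_of_finite (f := lam N)
    have hNw : 0 ≤ (N : ℝ) * w := mul_nonneg N.cast_nonneg hw
    refine ⟨Pi.single j √(N * w), fun _ => ⟨?_, ?_⟩⟩
    · rw [Finset.sum_eq_single j (fun i _ hij => by simp [hij]) (by simp)]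
      rw [Pi.single_eq_same, Real.sq_sqrt hNw]
    · rw [Finset.sum_eq_single j (fun i _ hij => by simp [hij]) (by simp)]
      rw [Pi.single_eq_same, Real.sq_sqrt hNw, hj]
  choose m hm using h
  exact ⟨m, hm⟩

theorem abs_rayleighRatio_sub_lt {N : ℕ} {x g : Fin N → ℝ} {α ε D : ℝ}
    (hD : D < (N : ℝ)⁻¹ * ∑ i, g i ^ 2) (hD0 : 0 < D)
    (h : |(N : ℝ)⁻¹ * ∑ i, (x i - α) * g i ^ 2| < ε * D) : |rayleighRatio x g - α| < ε := by
  have hY : 0 < (N : ℝ)⁻¹ * ∑ i, g i ^ 2 := hD0.trans hD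
  have hN : (N : ℝ)⁻¹ ≠ 0 := fun h0 => by simp [h0] at hY
  have hg : ∑ i, g i ^ 2 ≠ 0 := fun h0 => by simp [h0] at hY
  have h1 : rayleighRatio x g - α
      = ((N : ℝ)⁻¹ * ∑ i, (x i - α) * g i ^ 2) / ((N : ℝ)⁻¹ * ∑ i, g i ^ 2) := by
    rw [mul_div_mul_left _ _ hN, rayleighRatio, eq_div_iff hg, sub_mul, div_mul_cancel₀ _ hg]
    simp_rw [sub_mul]
    rw [Finset.sum_sub_distrib, ← Finset.mul_sum]
  have hε : 0 < ε := by
    by_contra! hcon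
    have := (abs_nonneg _).trans_lt h
    nlinarith
  rw [h1, abs_div, abs_of_pos hY, div_lt_iff₀ hY]
  exact h.trans (mul_lt_mul_of_pos_left hD hε)

/-- Substitute `g_i = m_i + √(v(λ_i)) ξ_i`. By `heq` the normalised `∑ (λ_i - α) g_i²` tends to zero
in probability, while `∑ g_i² / N` tends to `2D > 0` and the log-density per coordinate to `J`. So
with probability at least one half the ratio is within `ε` of `α` and the density is at least `exp
(zN)`, for any `z < J`. -/
theorem le_expGrowthInf_rayleighLaw (hyp : SpectralHypothesis lam μ lmin lmax) {c d : ℝ}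
    (hc : c < lmin) (hd : lmax < d) {v : ℝ → ℝ} (hv : ContinuousOn v (Icc c d))
    (hv0 : ∀ l ∈ Icc c d, 0 < v l) {α w ε : ℝ} (hw : 0 ≤ w)
    (heq : ∫ l, (l - α) * v l ∂μ + w * (lmax - α) = 0) (hε : 0 < ε) :
    ((∫ l, (1 - v l) / 2 ∂μ + ∫ l, Real.log (v l) / 2 ∂μ - w / 2 : ℝ) : EReal)
      ≤ expGrowthInf fun N => rayleighLaw lam N (Ioo (α - ε) (α + ε)) := by
  set J : ℝ := ∫ l, (1 - v l) / 2 ∂μ + ∫ l, Real.log (v l) / 2 ∂μ - w / 2 with hJ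
  have hsub : Icc lmin lmax ⊆ Icc c d := Icc_subset_Icc hc.le hd.le
  set D : ℝ := (∫ l, v l ∂μ + w) / 2 with hD
  have hD0 : 0 < D := by
    have : 0 < ∫ l, v l ∂μ :=
      integral_pos_of_ae_pos (integrable_of_continuousOn_Icc hyp.ae_mem_Icc (hv.mono hsub))
        (hyp.ae_mem_Icc.mono fun l hl => hv0 l (hsub hl))
    positivity
  obtain ⟨m, hm⟩ := exists_shift_at_max lam hw
  have hm' := (eventually_gt_atTop 0).mono hm
  have hsq : ContinuousOn (fun l => √(v l)) (Icc c d) := hv.sqrt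
  refine EReal.ge_of_forall_gt_iff_ge.1 fun z hz => ?_
  have hz : z < J := EReal.coe_lt_coe_iff.1 hz
  have t1 := tendsto_stdGaussianPi_spectral_deviation hyp hc hd
    (p := fun l => (l - α) * v l) (q := fun l => 2 * (l - α) * √(v l)) (r := fun _ => 0)
    (by fun_prop) (by fun_prop) (by fun_prop) 1 (-α) hm' (show 0 < ε * D by positivity)
  have t2 := tendsto_stdGaussianPi_spectral_deviation hyp hc hd
    (p := v) (q := fun l => 2 * √(v l)) (r := fun _ => 0)
    hv (by fun_prop) (by fun_prop) 0 1 hm' hD0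
  have t3 := tendsto_stdGaussianPi_spectral_deviation hyp hc hd
    (p := fun l => (1 - v l) / 2) (q := fun l => -√(v l)) (r := fun l => Real.log (v l) / 2)
    (by fun_prop) (by fun_prop) ((hv.log fun l hl => (hv0 l hl).ne').div_const 2)
    0 (-1 / 2) hm' (sub_pos.2 hz)
  have t := (t1.add t2).add t3
  simp only [add_zero] at t
  have hhalf := t.eventually_le_const (show (0 : ℝ≥0∞) < 2⁻¹ by simp)
  rw [← expGrowthInf_exp (a := (z : EReal))]
  refine expGrowthInf_of_eventually_ge (b := 2⁻¹) (by simp) ?_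
  filter_upwards [hhalf, hyp.eventually_mem_Icc hc hd, eventually_gt_atTop 0] with N h1 h2 hN
  have hN' : (0 : ℝ) < N := Nat.cast_pos.2 hN
  set σ : Fin N → ℝ := fun i => √(v (lam N i)) with hσ
  have hσ0 : ∀ i, 0 < σ i := fun i => Real.sqrt_pos.2 (hv0 _ (h2 i))
  have hσ2 : ∀ i, σ i ^ 2 = v (lam N i) := fun i => Real.sq_sqrt (hv0 _ (h2 i)).le
  rw [rayleighLaw_apply _ _ measurableSet_Ioo]
  refine le_trans ?_ (exp_mul_stdGaussianPi_le (m N) hσ0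
    (measurable_rayleighRatio (lam N) measurableSet_Ioo) (z * N))
  have hexp : EReal.exp ((z : EReal) * N) = ENNReal.ofReal (Real.exp (z * N)) := by
    rw [← EReal.coe_coe_eq_natCast, ← EReal.coe_mul, EReal.exp_coe]
  rw [hexp, mul_comm]
  gcongr
  -- If the good event had probability below one half, then together with the three deviation
  -- events, of total at most one half, it could not cover the whole space.
  by_contra! hcon
  have hlt := ENNReal.add_lt_add_of_lt_of_le (ne_top_of_le_ne_top (by simp) h1) hcon h1
  rw [ENNReal.inv_two_add_inv_two] at hlt
  refine hlt.not_ge ?_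
  rw [← measure_univ (μ := stdGaussianPi N)]
  refine le_trans (measure_mono ?_) ((measure_union_le _ _).trans (add_le_add_right
    ((measure_union_le _ _).trans (add_le_add_left (measure_union_le _ _) _)) _))
  intro ξ _
  by_contra hξ
  simp only [mem_union, mem_ofPred_eq, not_or, not_le] at hξ
  obtain ⟨hgood, ⟨e1, e2⟩, e3⟩ := hξ
  refine hgood ⟨?_, ?_⟩
  · have hX : ∀ i, (lam N i - α) * v (lam N i) * ξ i ^ 2
        + 2 * (lam N i - α) * √(v (lam N i)) * m N i * ξ i
        + (0 + (1 * lam N i + -α) * m N i ^ 2) = (lam N i - α) * affineMap (m N) σ ξ i ^ 2 := by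
      intro i
      simp only [affineMap]
      rw [add_sq, mul_pow, hσ2]
      ring
    have hY : ∀ i, v (lam N i) * ξ i ^ 2 + 2 * √(v (lam N i)) * m N i * ξ i
        + (0 + (0 * lam N i + 1) * m N i ^ 2) = affineMap (m N) σ ξ i ^ 2 := by
      intro i
      simp only [affineMap]
      rw [add_sq, mul_pow, hσ2]
      ring
    simp_rw [hX] at e1
    simp_rw [hY] at e2
    have e4 : ∫ l, (l - α) * v l ∂μ + ∫ _, (0 : ℝ) ∂μ + (1 * lmax + -α) * w = 0 := by
      rw [integral_zero]
      linear_combination heq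
    have e5 : ∫ l, v l ∂μ + ∫ _, (0 : ℝ) ∂μ + (0 * lmax + 1) * w = 2 * D := by
      rw [integral_zero, hD]
      ring
    rw [e4, sub_zero] at e1
    rw [e5] at e2
    have := abs_rayleighRatio_sub_lt (x := lam N) (by linarith [(abs_lt.1 e2).1]) hD0 e1
    rw [abs_lt] at this
    exact ⟨by linarith, by linarith⟩
  · have hZ : ∀ i, (1 - v (lam N i)) / 2 * ξ i ^ 2 + -√(v (lam N i)) * m N i * ξ i
        + (Real.log (v (lam N i)) / 2 + (0 * lam N i + -1 / 2) * m N i ^ 2)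
        = gaussianLogDensity (m N i) (σ i) (affineMap (m N) σ ξ i) := by
      intro i
      have h4 : v (lam N i) ≠ 0 := (hv0 _ (h2 i)).ne'
      have h5 : Real.log (σ i) = Real.log (v (lam N i)) / 2 :=
        Real.log_sqrt (hv0 _ (h2 i)).le
      simp only [affineMap, gaussianLogDensity]
      rw [h5, add_sub_cancel_left, add_sq, mul_pow, hσ2]
      field_simp
      ring
    simp_rw [hZ] at e3
    have e4 : ∫ l, (1 - v l) / 2 ∂μ + ∫ l, Real.log (v l) / 2 ∂μ + (0 * lmax + -1 / 2) * w = J := by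
      rw [hJ]
      ring
    rw [e4] at e3
    have e5 : z < (N : ℝ)⁻¹
        * ∑ i, gaussianLogDensity (m N i) (σ i) (affineMap (m N) σ ξ i) := by
      linarith [(abs_lt.1 e3).1]
    rw [inv_mul_eq_div, lt_div_iff₀ hN'] at e5
    exact e5.le

theorem le_expGrowthInf_rayleighLaw_spectralMean (hyp : SpectralHypothesis lam μ lmin lmax)
    {ε : ℝ} (hε : 0 < ε) : 0 ≤ expGrowthInf fun N =>
      rayleighLaw lam N (Ioo (spectralMean μ - ε) (spectralMean μ + ε)) := by
  have h := le_expGrowthInf_rayleighLaw hyp (sub_one_lt lmin) (lt_add_one lmax)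
    (v := fun _ => 1) (α := spectralMean μ) continuousOn_const (fun _ _ => one_pos) le_rfl ?_ hε
  · simpa using h
  · have hi := integrable_id_of_ae_mem_Icc hyp.ae_mem_Icc
    simp only [mul_one]
    rw [integral_sub hi (integrable_const _), ← spectralMean]
    simp

/-- Use the Chernoff-tilted variance `v(l) = (κ - α)/(κ - l)`. It gives `∫ (l - α) v dμ = (κ - α)(x
- 1) ≤ 0` with `x = (κ - α) H(κ)`. The shift repairs this deficit, and the second term of the bound
is its net cost, zero when `x = 1`. -/
theorem le_expGrowthInf_rayleighLaw_of_le_one (hyp : SpectralHypothesis lam μ lmin lmax)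
    {α κ ε : ℝ} (hα : α < lmax) (hκ : lmax < κ) (h1 : (κ - α) * hilbertTransform μ κ ≤ 1)
    (hε : 0 < ε) :
    ((-(hFun μ α κ / 2) - (1 - (κ - α) * hilbertTransform μ κ) / 2 * ((κ - lmax) / (lmax - α)) :
      ℝ) : EReal) ≤ expGrowthInf fun N => rayleighLaw lam N (Ioo (α - ε) (α + ε)) := by
  obtain ⟨d, hd, hdκ⟩ := exists_between hκ
  have hμ := hyp.ae_mem_Icc
  have hi := integrable_inv_sub hμ hκ
  have hκα : 0 < κ - α := by linarith
  have hlα : 0 < lmax - α := by linarith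
  have hv0 : ∀ l ∈ Icc (lmin - 1) d, 0 < (κ - α) * (1 / (κ - l)) := fun l hl =>
    mul_pos hκα (one_div_pos.2 (by linarith [hl.2]))
  have hv : ContinuousOn (fun l => (κ - α) * (1 / (κ - l))) (Icc (lmin - 1) d) :=
    continuousOn_const.mul (continuousOn_const.div (by fun_prop) fun l hl => by linarith [hl.2])
  have hH : ∫ l, (κ - α) * (1 / (κ - l)) ∂μ = (κ - α) * hilbertTransform μ κ :=
    integral_const_mul _ _
  set x : ℝ := (κ - α) * hilbertTransform μ κ with hx
  have e1 : ∫ l, (l - α) * ((κ - α) * (1 / (κ - l))) ∂μ = (κ - α) * (x - 1) := by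
    have : ∀ᵐ l ∂μ, (l - α) * ((κ - α) * (1 / (κ - l)))
        = (κ - α) * ((κ - α) * (1 / (κ - l)) - 1) := by
      filter_upwards [hμ] with l hl
      have : κ - l ≠ 0 := by linarith [hl.2]
      field_simp
      ring
    rw [integral_congr_ae this, integral_const_mul,
      integral_sub (hi.const_mul _) (integrable_const _), hH]
    simp
  have e2 : ∫ l, (1 - (κ - α) * (1 / (κ - l))) / 2 ∂μ = (1 - x) / 2 := by
    rw [integral_div, integral_sub (integrable_const _) (hi.const_mul _), hH]
    simp
  have e3 : ∫ l, Real.log ((κ - α) * (1 / (κ - l))) / 2 ∂μ = -(hFun μ α κ / 2) := by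
    rw [integral_div, hFun, ← neg_div, ← integral_neg]
    congr 2
    ext l
    rw [← Real.log_inv, inv_div, mul_one_div]
  -- The weight `w` is the one that solves the centring equation.
  have h := le_expGrowthInf_rayleighLaw hyp (sub_one_lt lmin) hd hv hv0 (α := α)
    (w := (κ - α) * (1 - x) / (lmax - α))
    (div_nonneg (mul_nonneg hκα.le (by linarith)) hlα.le) ?_ hε
  · rw [e2, e3] at h
    refine le_trans (le_of_eq ?_) h
    congr 1
    field_simp
    ring
  · rw [e1, div_mul_cancel₀ _ hlα.ne']
    ring

/-- The local lower bound to the right of the mean. -/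
theorem neg_rateT_le_expGrowthInf (hyp : SpectralHypothesis lam μ lmin lmax) {α ε : ℝ}
    (hm : spectralMean μ ≤ α) (hε : 0 < ε) : -rateT μ lmin lmax α
      ≤ expGrowthInf fun N => rayleighLaw lam N (Ioo (α - ε) (α + ε)) := by
  have hμ := hyp.ae_mem_Icc
  rcases eq_or_lt_of_le hm with rfl | hm
  · rw [rateT_spectralMean, neg_zero]
    exact le_expGrowthInf_rayleighLaw_spectralMean hyp hε
  rcases lt_or_ge α lmax with hα | hα
  · obtain ⟨t, ht, hr⟩ := exists_rateT_eq_of_spectralMean_lt hμ hm hα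
    rw [ht, ← EReal.coe_neg]
    rcases hr.cases with ⟨κ, hκ, h1, h2⟩ | ⟨h1, h2⟩
    · have h := le_expGrowthInf_rayleighLaw_of_le_one hyp hα hκ h1.le hε
      rw [h1, h2] at h
      simpa using h
    -- Since `0 < (κ - α) H(κ) ≤ 1`, the excess cost is at most `½ (κ - lmax)/(lmax - α)`, which
    -- vanishes at `lmax`.
    · have h3 : Tendsto (fun κ => -(hFun μ α κ / 2) - 1 / 2 * ((κ - lmax) / (lmax - α)))
          (𝓝[>] lmax) (𝓝 (-(2 * t / 2) - 1 / 2 * ((lmax - lmax) / (lmax - α)))) := by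
        refine (h2.div_const 2).neg.sub (tendsto_const_nhds.mul (Tendsto.div_const ?_ _))
        exact (tendsto_nhdsWithin_of_tendsto_nhds tendsto_id).sub_const lmax
      have h4 : -(2 * t / 2) - 1 / 2 * ((lmax - lmax) / (lmax - α)) = -t := by
        simp
      rw [h4] at h3
      refine le_of_tendsto (EReal.tendsto_coe.2 h3) ?_
      filter_upwards [self_mem_nhdsWithin] with κ hκ
      have hκ' : lmax < κ := hκ
      refine le_trans (EReal.coe_le_coe_iff.2 ?_)
        (le_expGrowthInf_rayleighLaw_of_le_one hyp hα hκ' (h1 κ hκ') hε)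
      have h5 := hilbertTransform_pos hμ hκ'
      have h6 : 0 ≤ (κ - lmax) / (lmax - α) := div_nonneg (by linarith) (by linarith)
      have h7 : 0 < (κ - α) * hilbertTransform μ κ := mul_pos (by linarith) h5
      nlinarith
  · rw [rateT_eq_top hμ hm.ne' fun h => absurd h.2 hα.not_gt, EReal.neg_top]
    exact bot_le

end LowerBound

/-! ### The large deviation principle -/

section LargeDeviations

open ExpGrowth

variable {lam : (N : ℕ) → Fin N → ℝ} {μ : Measure ℝ} [IsProbabilityMeasure μ] {lmin lmax : ℝ}

/-- All coefficients `λ_i - α` are negative, so the event forces `g = 0`, a null set in positive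
dimension. -/
theorem rayleighLaw_Ici_eq_zero {N : ℕ} (hN : 0 < N) {α : ℝ} (h : ∀ i, lam N i < α) :
    rayleighLaw lam N (Ici α) = 0 := by
  have : Nonempty (Fin N) := ⟨⟨0, hN⟩⟩
  have : NullSingletonClass (gaussianReal 0 1) := nullSingletonClass_gaussianReal one_ne_zero
  rw [rayleighLaw_apply _ _ measurableSet_Ici]
  refine measure_mono_null (t := {0}) (fun g hg => ?_)
    (measure_singleton (μ := Measure.pi fun _ : Fin N => gaussianReal 0 1) 0)
  have h1 := sum_sub_mul_sq_nonneg_of_le_rayleighRatio (α := α) hg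
  have h2 : ∀ i ∈ Finset.univ, (lam N i - α) * g i ^ 2 ≤ 0 := fun i _ =>
    mul_nonpos_of_nonpos_of_nonneg (by linarith [h i]) (sq_nonneg _)
  have h3 := (Finset.sum_eq_zero_iff_of_nonpos h2).1 (le_antisymm (Finset.sum_nonpos h2) h1)
  refine mem_singleton_iff.2 (funext fun i => ?_)
  have h4 := h3 i (Finset.mem_univ i)
  exact pow_eq_zero_iff two_ne_zero |>.1
    ((mul_eq_zero.1 h4).resolve_left (by linarith [h i]))

theorem expGrowthSup_rayleighLaw_nonpos (E : Set ℝ) :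
    expGrowthSup (fun N => rayleighLaw lam N E) ≤ 0 := by
  rw [← expGrowthSup_const (b := 1) one_ne_zero ENNReal.one_ne_top]
  exact expGrowthSup_monotone fun N => rayleighLaw_le_one lam N E

/-- The upper bound for half-lines to the right of the mean. -/
theorem expGrowthSup_rayleighLaw_Ici_le_neg_rateT (hyp : SpectralHypothesis lam μ lmin lmax)
    {α : ℝ} (hm : spectralMean μ ≤ α) :
    expGrowthSup (fun N => rayleighLaw lam N (Ici α)) ≤ -rateT μ lmin lmax α := by
  have hμ := hyp.ae_mem_Icc
  rcases eq_or_lt_of_le hm with rfl | hm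
  · rw [rateT_spectralMean, neg_zero]
    exact expGrowthSup_rayleighLaw_nonpos _
  rcases lt_trichotomy α lmax with hα | rfl | hα
  · obtain ⟨t, ht, hr⟩ := exists_rateT_eq_of_spectralMean_lt hμ hm hα
    rw [ht, ← EReal.coe_neg]
    rcases hr.cases with ⟨κ, hκ, -, h2⟩ | ⟨-, h2⟩
    · have h := expGrowthSup_rayleighLaw_Ici_le hyp hα.le hκ
      rwa [h2, mul_div_cancel_left₀ _ two_ne_zero] at h
    · have h3 := (h2.div_const 2).neg
      rw [mul_div_cancel_left₀ _ two_ne_zero] at h3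
      refine ge_of_tendsto (EReal.tendsto_coe.2 h3) ?_
      filter_upwards [self_mem_nhdsWithin] with κ hκ
      exact expGrowthSup_rayleighLaw_Ici_le hyp hα.le hκ
  -- At `α = lmax` the Chernoff bound still applies, and `h_α` is unbounded, so the growth rate is
  -- `-∞`.
  · rw [rateT_eq_top hμ hm.ne' fun h => lt_irrefl _ h.2, EReal.neg_top, le_bot_iff,
      EReal.eq_bot_iff_forall_lt]
    intro y
    obtain ⟨κ, hκ, hκ'⟩ := exists_lt_hFun_right_endpoint hμ hm (2 * -y)
    exact (expGrowthSup_rayleighLaw_Ici_le hyp le_rfl hκ).trans_lt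
      (EReal.coe_lt_coe_iff.2 (by linarith))
  · rw [rateT_eq_top hμ hm.ne' fun h => absurd h.2 hα.le.not_gt, EReal.neg_top, le_bot_iff,
      ← expGrowthSup_zero]
    obtain ⟨d, hd, hdα⟩ := exists_between hα
    refine expGrowthSup_congr ?_
    filter_upwards [hyp.eventually_mem_Icc (sub_one_lt lmin) hd, eventually_gt_atTop 0] with N h1 h2
    exact rayleighLaw_Ici_eq_zero h2 fun i => (h1 i).2.trans_lt hdα

/-- The upper bound for half-lines to the left of the mean. -/
theorem expGrowthSup_rayleighLaw_Iic_le_neg_rateT (hyp : SpectralHypothesis lam μ lmin lmax)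
    {α : ℝ} (hm : α ≤ spectralMean μ) :
    expGrowthSup (fun N => rayleighLaw lam N (Iic α)) ≤ -rateT μ lmin lmax α := by
  have h := expGrowthSup_rayleighLaw_Ici_le_neg_rateT hyp.reflect (α := -α)
    (by rw [spectralMean_reflection]; exact neg_le_neg hm)
  rw [rateT_reflection hyp.ae_mem_Icc hm] at h
  simp_rw [rayleighLaw_reflect lam _ measurableSet_Ici] at h
  simpa using h

/-- The local lower bound to the left of the mean. -/
theorem neg_rateT_le_expGrowthInf_left (hyp : SpectralHypothesis lam μ lmin lmax) {α ε : ℝ}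
    (hm : α ≤ spectralMean μ) (hε : 0 < ε) : -rateT μ lmin lmax α
      ≤ expGrowthInf fun N => rayleighLaw lam N (Ioo (α - ε) (α + ε)) := by
  have h := neg_rateT_le_expGrowthInf hyp.reflect (α := -α)
    (by rw [spectralMean_reflection]; exact neg_le_neg hm) hε
  rw [rateT_reflection hyp.ae_mem_Icc hm] at h
  simp_rw [rayleighLaw_reflect lam _ measurableSet_Ioo] at h
  have e : Neg.neg ⁻¹' Ioo (-α - ε) (-α + ε) = Ioo (α - ε) (α + ε) := by
    ext x
    simp only [mem_preimage, mem_Ioo]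
    constructor <;> rintro ⟨h1, h2⟩ <;> constructor <;> linarith
  rwa [e] at h

theorem le_expGrowthInf_rayleighLaw_of_isOpen (hyp : SpectralHypothesis lam μ lmin lmax)
    {G : Set ℝ} (hG : IsOpen G) :
    -(⨅ x ∈ G, rateT μ lmin lmax x) ≤ expGrowthInf fun N => rayleighLaw lam N G := by
  rw [EReal.neg_le]
  refine le_iInf₂ fun α hα => ?_
  rw [EReal.neg_le]
  obtain ⟨ε, hε, hεG⟩ := Metric.isOpen_iff.1 hG α hα
  rw [Real.ball_eq_Ioo] at hεG
  have hmono : expGrowthInf (fun N => rayleighLaw lam N (Ioo (α - ε) (α + ε)))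
      ≤ expGrowthInf fun N => rayleighLaw lam N G :=
    expGrowthInf_monotone fun N => measure_mono hεG
  refine le_trans ?_ hmono
  rcases le_total (spectralMean μ) α with h | h
  · exact neg_rateT_le_expGrowthInf hyp h hε
  · exact neg_rateT_le_expGrowthInf_left hyp h hε

/-- Cut `F` at the mean. Each nonempty piece lies in the half-line starting at its point closest to
`m`, which belongs to `F` because `F` is closed, and the growth rate of a sum is the maximum of the
rates. No monotonicity of `T` is needed. -/
theorem expGrowthSup_rayleighLaw_le_of_isClosed (hyp : SpectralHypothesis lam μ lmin lmax)
    {F : Set ℝ} (hF : IsClosed F) :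
    expGrowthSup (fun N => rayleighLaw lam N F) ≤ -(⨅ x ∈ F, rateT μ lmin lmax x) := by
  have hr : expGrowthSup (fun N => rayleighLaw lam N (F ∩ Ici (spectralMean μ)))
      ≤ -(⨅ x ∈ F, rateT μ lmin lmax x) := by
    rcases (F ∩ Ici (spectralMean μ)).eq_empty_or_nonempty with h | h
    · simp_rw [h, measure_empty]
      exact expGrowthSup_zero.trans_le bot_le
    · have hb : BddBelow (F ∩ Ici (spectralMean μ)) := ⟨spectralMean μ, fun x hx => hx.2⟩
      have hmem := (hF.inter isClosed_Ici).csInf_mem h hb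
      have hmono : expGrowthSup (fun N => rayleighLaw lam N (F ∩ Ici (spectralMean μ)))
          ≤ expGrowthSup fun N => rayleighLaw lam N (Ici (sInf (F ∩ Ici (spectralMean μ)))) :=
        expGrowthSup_monotone fun N => measure_mono fun x hx => csInf_le hb hx
      exact hmono.trans ((expGrowthSup_rayleighLaw_Ici_le_neg_rateT hyp hmem.2).trans
        (EReal.neg_le_neg_iff.2 (iInf₂_le _ hmem.1)))
  have hl : expGrowthSup (fun N => rayleighLaw lam N (F ∩ Iic (spectralMean μ)))
      ≤ -(⨅ x ∈ F, rateT μ lmin lmax x) := by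
    rcases (F ∩ Iic (spectralMean μ)).eq_empty_or_nonempty with h | h
    · simp_rw [h, measure_empty]
      exact expGrowthSup_zero.trans_le bot_le
    · have hb : BddAbove (F ∩ Iic (spectralMean μ)) := ⟨spectralMean μ, fun x hx => hx.2⟩
      have hmem := (hF.inter isClosed_Iic).csSup_mem h hb
      have hmono : expGrowthSup (fun N => rayleighLaw lam N (F ∩ Iic (spectralMean μ)))
          ≤ expGrowthSup fun N => rayleighLaw lam N (Iic (sSup (F ∩ Iic (spectralMean μ)))) :=
        expGrowthSup_monotone fun N => measure_mono fun x hx => le_csSup hb hx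
      exact hmono.trans ((expGrowthSup_rayleighLaw_Iic_le_neg_rateT hyp hmem.2).trans
        (EReal.neg_le_neg_iff.2 (iInf₂_le _ hmem.1)))
  refine le_trans (expGrowthSup_monotone fun N => ?_) (le_trans
    (expGrowthSup_add (u := fun N => rayleighLaw lam N (F ∩ Ici (spectralMean μ)))
      (v := fun N => rayleighLaw lam N (F ∩ Iic (spectralMean μ)))).le (max_le hr hl))
  refine (measure_mono fun x hx => ?_).trans (measure_union_le _ _)
  rcases le_total (spectralMean μ) x with h | h
  · exact Or.inl ⟨hx, h⟩
  · exact Or.inr ⟨hx, h⟩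

theorem inv_mul_log_eq (N : ℕ) (x : ℝ≥0∞) :
    (((N : ℝ)⁻¹ : ℝ) : EReal) * ENNReal.log x = ENNReal.log x / N := by
  rw [EReal.div_eq_inv_mul, EReal.coe_inv, EReal.coe_coe_eq_natCast]

theorem satisfiesLDP_rayleighLaw (hyp : SpectralHypothesis lam μ lmin lmax) :
    SatisfiesLDP (rayleighLaw lam) (rateT μ lmin lmax) where
  upper F hF := by
    simp_rw [inv_mul_log_eq]
    exact expGrowthSup_rayleighLaw_le_of_isClosed hyp hF
  lower G hG := by
    simp_rw [inv_mul_log_eq]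
    exact le_expGrowthInf_rayleighLaw_of_isOpen hyp hG

end LargeDeviations

/-- The first six clauses say that `H_max`, `H_min`, `K`, `Q`, `h_α^max` and `h_α^min`, through
which `T` is defined, are well defined; the last two are the large deviation principle. -/
theorem mainTheorem8 (lam : (N : ℕ) → Fin N → ℝ) (μ : Measure ℝ) [IsProbabilityMeasure μ]
    (lmin lmax : ℝ) (hyp : SpectralHypothesis lam μ lmin lmax) :
    (0 < hilbertMax μ lmax ∧
      Tendsto (fun z => (hilbertTransform μ z : EReal)) (𝓝[>] lmax) (𝓝 (hilbertMax μ lmax))) ∧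
    (hilbertMin μ lmin < 0 ∧
      Tendsto (fun z => (hilbertTransform μ z : EReal)) (𝓝[<] lmin) (𝓝 (hilbertMin μ lmin))) ∧
    (∀ γ ∈ domainK μ lmin lmax, ∃! z, z ∈ (Icc lmin lmax)ᶜ ∧ hilbertTransform μ z = γ) ∧
    (∀ α ∈ domainQ μ lmin lmax, ∃! γ, γ ∈ domainK μ lmin lmax ∧ rTransform μ lmin lmax γ = α) ∧
    (∀ α, alphaMax μ lmax ≤ α → α < lmax →
      Tendsto (hFun μ α) (𝓝[>] lmax) (𝓝 (hMax μ lmax α))) ∧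
    (∀ α, lmin < α → α ≤ alphaMin μ lmin →
      Tendsto (hFun μ α) (𝓝[<] lmin) (𝓝 (hMin μ lmin α))) ∧
    IsGoodRateFunction (rateT μ lmin lmax) ∧
    SatisfiesLDP (rayleighLaw lam) (rateT μ lmin lmax) := by
  have hμ := hyp.ae_mem_Icc
  refine ⟨⟨hilbertMax_pos hμ, tendsto_hilbertMax hμ⟩, ⟨hilbertMin_neg hμ, ?_⟩,
    fun γ hγ => existsUnique_hilbertTransform_eq hμ hγ,
    fun α hα => existsUnique_rTransform_eq hμ hα, fun α h1 h2 => tendsto_hMax hμ h1 h2,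
    fun α h1 h2 => ?_, isGoodRateFunction_rateT hμ, satisfiesLDP_rayleighLaw hyp⟩
  · rw [hilbertMin_eq hμ]
    exact tendsto_hilbertTransform_nhdsLT hμ
  · rw [hMin_eq hμ h2 h1]
    exact tendsto_hFun_nhdsLT hμ h2 h1
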